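/- **Setting.** Let $d\in\{2,3\}$, $T>0$, and let $K$ be the Coulomb potential $K(x)=\pm\frac1{2\pi}\log|x|$ if $d=2$, and the screened Coulomb potential $K(x)=\pm\frac{e^{-\kappa|x|}}{4\pi|x|}$ with $\kappa>0$ if $d=3$. Consider the magnetized Vlasov–Poisson equation $$\partial_t f+v\cdot\nabla_xf-(\nabla K\star\rho_f+v\wedge B)\cdot\nabla_vf=0,\qquad \rho_f(t,x)=\int_{\mathbb R^d}f(t,x,v)\,dv,\qquad f|_{t=0}=f^{\rm in},\tag{1}$$ with an external magnetic field $B$: for $d=3$ it is a vector field $B:[0,T]\times\mathbb R^3\to\mathbb R^3$; for $d=2$ it is orthogonal to the plane, i.e. a scalar function $B:[0,T]\times\mathbb R^2\to\mathbb R$ with $v\wedge B=B\,(v_2,-v_1)$. A *classical solution* of (1) on $[0,T]$ is a function $f\ge 0$, continuous on $[0,T]\times\mathbb R^{2d}$ and $C^1$ on $(0,T)\times\mathbb R^{2d}$, with $f\in L^\infty([0,T];L^1\cap L^\infty(\mathbb R^{2d}))$, for which the integrals defining $\rho_f(t,x)$ and $\nabla K\star\rho_f(t,x)$ converge absolutely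 for all $(t,x)\in[0,T]\times\mathbb R^d$, the field $\nabla K\star\rho_f(t,x)$ grows at most linearly in $x$ uniformly in $t\in[0,T]$, (1) holds pointwise on $(0,T)\times\mathbb R^{2d}$, and $f(0)=f^{\rm in}$. Put $b=2$ if $d=2$, $b=\frac32$ if $d=3$, and $b'=\frac b{b-1}$. Write $M_k(0)=\iint|v|^kf^{\rm in}\,dx\,dv$, $N_k(0)=\iint|x|^kf^{\rm in}\,dx\,dv$, $$\|g\|_{b,\infty}=\sup_{s>0}s\,|\{|g|>s\}|^{1/b},\qquad \|g\|_{b',1}=b'\int_0^\infty|\{|g|>s\}|^{1/b'}\,ds$$ for the norms of the weak Lebesgue space $L^{b,\infty}(\mathbb R^d)$ and of the Lorentz space $L^{b',1}(\mathbb R^d)$. **Assumptions.** Let $n\in\mathbb N$ with $n>d(b'-1)$, let $0\le f^{\rm in}\in L^1\cap L^\infty(\mathbb R^{2d})$ with $\|(1+|v|^n)f^{\rm in}\|_{L^\infty_{x,v}}<\infty$, and let $M_k(0)\le\mathbf M^{\rm in}_k$ for all $0\le k\le n$, with constants $\mathbf M_k^{\rm in}>0$. If $d=3$, let moreover $n\ge4$,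 $c\in(\frac75,\frac32)$, $a=\frac3c-1$, $B_0>0$, and assume that $$\|x\wedge B(t,x)\|_{L^\infty_x}\le B_0t^{-a},\qquad\|B(t,\cdot)\|_{L^\infty}\le B_0t^{-a}\qquad(0<t\le T),$$ that $N_k(0)\le\mathbf N^{\rm in}_k$ for all $0\le k\le n$, with constants $\mathbf N_k^{\rm in}>0$, and that $$\|f^{\rm in}\|_{L^1\cap L^\infty}+M_4(0)+N_4(0)\le\varepsilon_0 ,$$ where $\|\cdot\|_{L^1\cap L^\infty}=\max(\|\cdot\|_1,\|\cdot\|_\infty)$. **Theorem.** If $d=3$, there is an $\varepsilon_0>0$, depending only on $K$, $c$ and $B_0$, such that what follows holds under the assumptions above; if $d=2$, it holds without any such restriction. Let $f$ be a classical solution of (1) on $[0,T]$ with initial datum $f^{\rm in}$. Then: 1. $\|\nabla K\|_{b,\infty}<\infty$, $\|\rho_f\|_{L^\infty_tL^{b',1}_x}<\infty$, and with $c_n=\int_{\mathbb R^d}\frac{dv}{1+|v|^n}$, for all $t\in[0,T]$, $$\|\rho_f(t,\cdot)\|_{L^\infty}\le c_n\exp\!\Big(n\,\|\nabla K\|_{b,\infty}\,\|\rho_f\|_{L^\infty_tL^{b',1}_x}\,t\Big)\,\big\|(1+|v|^n)f^{\rm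 in}\big\|_{L^\infty_{x,v}} .$$ The same estimate holds, as an inequality in $[0,\infty]$ (with $0\cdot\infty=0$), with $\|\nabla K\|_{L^b}\|\rho_f\|_{L^\infty_tL^{b'}_x}$ in place of $\|\nabla K\|_{b,\infty}\|\rho_f\|_{L^\infty_tL^{b',1}_x}$. 2. $\rho_f\in L^\infty([0,T];L^\infty(\mathbb R^d))$. 3. There is a constant $\phi_0>0$ such that $\|\rho_f(t,\cdot)\|_{L^p}\le\phi_0$ for all $t\in[0,T]$ and all $p\in[1,\infty]$; in particular $\|\rho_f\|_{L^\infty_tL^p_x}\le\phi_0$ for all $p\in[1,\infty]$. -/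

import Mathlib

open MeasureTheory Set
open scoped ENNReal NNReal

noncomputable section

/-- The Euclidean space of positions, and of velocities. -/
abbrev Sp (d : ℕ) : Type := EuclideanSpace ℝ (Fin d)

/-! ### Norms -/

/-- The weak Lebesgue (quasi-)norm `sup_{s > 0} s |{ |g| > s }|^{1/p}`. -/
def weakLpNorm {d : ℕ} {F : Type*} [NormedAddCommGroup F] (p : ℝ) (g : Sp d → F) : ℝ≥0∞ :=
  ⨆ s : ℝ≥0, (s : ℝ≥0∞) * volume {x : Sp d | (s : ℝ≥0∞) < ‖g x‖ₑ} ^ (1 / p)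

/-- The Lorentz norm of `L^{p,1}`, namely `p ∫_0^∞ |{ |g| > s }|^{1/p} ds`. -/
def lorentzOneNorm {d : ℕ} {F : Type*} [NormedAddCommGroup F] (p : ℝ) (g : Sp d → F) : ℝ≥0∞ :=
  ENNReal.ofReal p *
    ∫⁻ s in Ioi (0 : ℝ), volume {x : Sp d | ENNReal.ofReal s < ‖g x‖ₑ} ^ (1 / p)

/-- The norm of `L^∞([0,T])` of a nonnegative function of time. -/
def timeSup (T : ℝ) (φ : ℝ → ℝ≥0∞) : ℝ≥0∞ :=
  essSup φ (volume.restrict (Icc 0 T))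

/-! ### Interaction potentials and Lorentz force -/

/-- The Coulomb potential in dimension two, `σ log |x| / (2π)`, where `σ = ± 1`. -/
def coulomb2 (σ : ℝ) (x : Sp 2) : ℝ := σ * (1 / (2 * Real.pi) * Real.log ‖x‖)

/-- The screened Coulomb potential in dimension three, `σ e^{-κ|x|} / (4π|x|)`,
where `σ = ± 1`. -/
def yukawa3 (σ κ : ℝ) (x : Sp 3) : ℝ := σ * (Real.exp (-κ * ‖x‖) / (4 * Real.pi * ‖x‖))

/-- The vector product in dimension three. -/
def wedge3 (v w : Sp 3) : Sp 3 := WithLp.toLp 2 (crossProduct (WithLp.ofLp v) (WithLp.ofLp w))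

/-- In dimension two the magnetic field is orthogonal to the plane, hence given by a scalar `β`,
and `v ∧ B = (v₁, v₂, 0) ∧ (0, 0, β) = β (v₂, -v₁)`. -/
def wedge2 (v : Sp 2) (β : ℝ) : Sp 2 := !₂[β * v 1, -(β * v 0)]

/-! ### Density, moments, force field -/

/-- The density `ρ_g(x) = ∫ g(x, v) dv`. -/
def density {d : ℕ} (g : Sp d → Sp d → ℝ) (x : Sp d) : ℝ := ∫ v, g x v

/-- The velocity moment `∬ |v|^k g(x, v) dx dv` of a nonnegative function. -/
def velMoment {d : ℕ} (k : ℕ) (g : Sp d → Sp d → ℝ) : ℝ≥0∞ :=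
  ∫⁻ z : Sp d × Sp d, ENNReal.ofReal (‖z.2‖ ^ k * g z.1 z.2)

/-- The position moment `∬ |x|^k g(x, v) dx dv` of a nonnegative function. -/
def posMoment {d : ℕ} (k : ℕ) (g : Sp d → Sp d → ℝ) : ℝ≥0∞ :=
  ∫⁻ z : Sp d × Sp d, ENNReal.ofReal (‖z.1‖ ^ k * g z.1 z.2)

/-- The `L^p` norm on phase space. -/
def phaseNorm {d : ℕ} (p : ℝ≥0∞) (g : Sp d → Sp d → ℝ) : ℝ≥0∞ :=
  eLpNorm (fun z : Sp d × Sp d => g z.1 z.2) p volume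

/-- The weighted norm `‖(1 + |v|^n) g(x, v)‖_{L^∞_{x,v}}`. -/
def weightedSup {d : ℕ} (n : ℕ) (g : Sp d → Sp d → ℝ) : ℝ≥0∞ :=
  phaseNorm ∞ (fun x v => (1 + ‖v‖ ^ n) * g x v)

/-- The field `(∇K ⋆ ρ)(x) = ∫ ρ(y) ∇K(x - y) dy`. -/
def gradConv {d : ℕ} (K : Sp d → ℝ) (ρ : Sp d → ℝ) (x : Sp d) : Sp d :=
  ∫ y, ρ y • gradient K (x - y)

/-! ### Classical solutions -/

/-- `f` is a classical solution on `[0,T]` of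
`∂_t f + v · ∇_x f - (∇K ⋆ ρ_f + v ∧ B) · ∇_v f = 0` with `f|_{t=0} = fin`.
The magnetic term `v ∧ B(t,x)` is the argument `wB t x v`. -/
structure IsClassicalSolution {d : ℕ} (K : Sp d → ℝ) (wB : ℝ → Sp d → Sp d → Sp d) (T : ℝ)
    (fin : Sp d → Sp d → ℝ) (f : ℝ → Sp d → Sp d → ℝ) : Prop where
  /-- `f` is continuous up to the initial and the final time. -/
  continuousOn : ContinuousOn (fun z : ℝ × Sp d × Sp d => f z.1 z.2.1 z.2.2) (Icc 0 T ×ˢ univ)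
  /-- `f` is `C^1` at the intermediate times. -/
  contDiffOn : ContDiffOn ℝ 1 (fun z : ℝ × Sp d × Sp d => f z.1 z.2.1 z.2.2) (Ioo 0 T ×ˢ univ)
  nonneg : ∀ t ∈ Icc 0 T, ∀ x v, 0 ≤ f t x v
  /-- `f` belongs to `L^∞([0,T]; L^1 ∩ L^∞)`. -/
  bounded : ∃ A : ℝ≥0, ∀ t ∈ Icc 0 T, phaseNorm 1 (f t) ≤ A ∧ phaseNorm ∞ (f t) ≤ A
  /-- The integral defining the density converges. -/
  density_exists : ∀ t ∈ Icc 0 T, ∀ x, Integrable (fun v => f t x v)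
  /-- The integral defining the field converges. -/
  field_exists : ∀ t ∈ Icc 0 T, ∀ x,
    Integrable (fun y => density (f t) y • gradient K (x - y))
  /-- The field grows at most linearly, so that characteristics do not reach infinity. -/
  field_growth : ∃ A : ℝ, ∀ t ∈ Icc 0 T, ∀ x, ‖gradConv K (density (f t)) x‖ ≤ A * (1 + ‖x‖)
  equation : ∀ t ∈ Ioo 0 T, ∀ x v,
    deriv (fun s => f s x v) t
      + inner ℝ v (gradient (fun y => f t y v) x)
      - inner ℝ (gradConv K (density (f t)) x + wB t x v) (gradient (fun w => f t x w) v) = 0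
  initial : f 0 = fin

/-! ### Exponents and the conclusion -/

/-- The exponent `b`: `2` in dimension two and `3/2` in dimension three. -/
def bExp (d : ℕ) : ℝ := if d = 2 then 2 else 3 / 2

/-- The conjugate exponent `b' = b / (b - 1)`. -/
def bConj (d : ℕ) : ℝ := bExp d / (bExp d - 1)

/-- The constant `c_n = ∫_{ℝ^d} dv / (1 + |v|^n)`. -/
def velConst (d n : ℕ) : ℝ := ∫ v : Sp d, 1 / (1 + ‖v‖ ^ n)

/-- The right-hand side `c_n exp(n a r t) ‖(1 + |v|^n) fin‖_∞`, with values in `[0,∞]`. -/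
def expBound {d : ℕ} (n : ℕ) (a r : ℝ≥0∞) (t : ℝ) (fin : Sp d → Sp d → ℝ) : ℝ≥0∞ :=
  ENNReal.ofReal (velConst d n)
    * EReal.exp (((n : ℝ≥0∞) * a * r * ENNReal.ofReal t : ℝ≥0∞) : EReal)
    * weightedSup n fin

/-- The bounds on the density of `f`: finiteness of the two norms in the exponent, the exponential
estimate for the dual pairs `(L^{b,∞}, L^{b',1})` and `(L^b, L^{b'})`, boundedness of the density,
and one constant that bounds all its `L^p` norms. -/
def DensityBounds {d : ℕ} (K : Sp d → ℝ) (n : ℕ) (T : ℝ) (fin : Sp d → Sp d → ℝ)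
    (f : ℝ → Sp d → Sp d → ℝ) : Prop :=
  weakLpNorm (bExp d) (gradient K) < ∞
  ∧ timeSup T (fun t => lorentzOneNorm (bConj d) (density (f t))) < ∞
  ∧ (∀ t ∈ Icc 0 T, eLpNorm (density (f t)) ∞ volume
      ≤ expBound n (weakLpNorm (bExp d) (gradient K))
          (timeSup T fun s => lorentzOneNorm (bConj d) (density (f s))) t fin)
  ∧ (∀ t ∈ Icc 0 T, eLpNorm (density (f t)) ∞ volume
      ≤ expBound n (eLpNorm (gradient K) (ENNReal.ofReal (bExp d)) volume)
          (timeSup T fun s =>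
            eLpNorm (density (f s)) (ENNReal.ofReal (bConj d)) volume) t fin)
  ∧ timeSup T (fun t => eLpNorm (density (f t)) ∞ volume) < ∞
  ∧ ∃ φ₀ : ℝ, 0 < φ₀ ∧ ∀ p : ℝ≥0∞, 1 ≤ p → ∀ t ∈ Icc 0 T,
      eLpNorm (density (f t)) p volume ≤ ENNReal.ofReal φ₀

end

open Filter Topology

/-! ### The interaction kernels -/

/-! Everything reduces to an a priori bound e for the field E = ∇K ⋆ ρ_f. The magnetic force is
orthogonal to v, so the transport derivative of 1 + |v|^n is at most n e (1 + |v|^n), and f (1 +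
|v|^n) grows at most like exp(n e t). Integration in v bounds ρ_f; together with the bound on the
mass this controls all Lebesgue and Lorentz norms in question (`densityBounds_of_bounded_field`).
Hölder's inequality for the pair (L^{b,∞}, L^{b',1}) then replaces the qualitative e by the product
of norms in the statement. Essential suprema in time control every single time because the majorant
of the field is lower semicontinuous (`fieldMajorant_le_of_ae`).

No regularity of B is available, so characteristics are avoided. Pointwise bounds come from a
maximum principle (`mul_weight_le`): at a maximum of a penalized f W only the derivative in the one
direction (1, v, -F) matters, and there the equation says that f has derivative zero. The penalty is
a power of 1 + |x|² + |v|², whose transport derivative is controlled by the linear growth of the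
field. Integral bounds come from testing with compactly supported weights that decrease along the
transport (`integral_mul_le`); the force is affine in v with skew linear part, hence divergence
free.

In dimension three the field is bounded by moments (`exists_field_bound_three`). The hypothesis on n
gives n ≥ 7, and moments of order seven propagate. At distance |w| < 1 from the evaluation point,
particles faster than |w|^{-2/7} are paid for by the moment, since |w|^{-2} ≤ |v|^7, and the slower
ones by the sup bound of f, which leaves the integrable singularity |w|^{-20/7}.

In dimension two no moments in x are given, and a barrier is used (`exists_field_bound_two`). If f
is concentrated on speeds below Y = R (1 + η⟨x⟩), with a tail of order n, then ρ_f is of order Y²,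
and splitting the kernel at distance 1/Y bounds the field by a multiple of Y, which is linear in R.
Hence a shift R(t) growing exponentially stays ahead of the acceleration, at a rate independent of η
(`mul_shiftWeight_exp_le`); taking η of order 1/⟨x⟩ removes the growth in x. -/

theorem norm_gradient_radial_le {d : ℕ} {h : ℝ → ℝ} {h' : ℝ} {x : Sp d} (hx : x ≠ 0)
    (hh : HasDerivAt h h' ‖x‖) : ‖gradient (fun y : Sp d => h ‖y‖) x‖ ≤ |h'| := by
  have hn : HasFDerivAt (fun y : Sp d => ‖y‖) (fderiv ℝ (fun y : Sp d => ‖y‖) x) x :=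
    ((contDiffAt_norm ℝ hx (n := 1)).differentiableAt (by norm_num)).hasFDerivAt
  have hc := hh.comp_hasFDerivAt x hn
  have hle : ‖fderiv ℝ (fun y : Sp d => ‖y‖) x‖ ≤ 1 := by
    simpa using norm_fderiv_le_of_lipschitz ℝ (f := fun y : Sp d => ‖y‖) (C := 1) (x₀ := x)
      lipschitzWith_one_norm
  have he : fderiv ℝ (fun y : Sp d => h ‖y‖) x = h' • fderiv ℝ (fun y : Sp d => ‖y‖) x := hc.fderiv
  rw [gradient, LinearIsometryEquiv.norm_map, he, norm_smul, Real.norm_eq_abs]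
  exact mul_le_of_le_one_right (abs_nonneg _) hle

theorem norm_gradient_coulomb2_le {σ : ℝ} (hσ : |σ| = 1) {x : Sp 2} (hx : x ≠ 0) :
    ‖gradient (coulomb2 σ) x‖ ≤ 1 / ‖x‖ ^ (2 - 1) := by
  have h0 : 0 < ‖x‖ := norm_pos_iff.2 hx
  have h1 : HasDerivAt (fun r : ℝ => σ * (1 / (2 * Real.pi) * Real.log r))
      (σ * (1 / (2 * Real.pi) * ‖x‖⁻¹)) ‖x‖ :=
    ((Real.hasDerivAt_log h0.ne').const_mul _).const_mul _
  refine (norm_gradient_radial_le hx h1).trans ?_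
  have hpi : 1 / (2 * Real.pi) ≤ 1 := by
    rw [div_le_one (by positivity)]; linarith [Real.pi_gt_three]
  rw [abs_mul, hσ, one_mul, abs_of_pos (by positivity), pow_one, one_div ‖x‖]
  exact mul_le_of_le_one_left (by positivity) hpi

theorem norm_gradient_yukawa3_le {σ κ : ℝ} (hσ : |σ| = 1) (hκ : 0 < κ) {x : Sp 3} (hx : x ≠ 0) :
    ‖gradient (yukawa3 σ κ) x‖ ≤ 1 / ‖x‖ ^ (3 - 1) := by
  have h0 : 0 < ‖x‖ := norm_pos_iff.2 hx
  have hpi := Real.pi_gt_three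
  have h1 := (((((hasDerivAt_id ‖x‖).const_mul (-κ)).exp).div
    ((hasDerivAt_id ‖x‖).const_mul (4 * Real.pi)) (by simp; positivity)).const_mul σ)
  refine (norm_gradient_radial_le hx h1).trans ?_
  simp only [id, mul_one]
  rw [abs_mul, hσ, one_mul]
  set r := ‖x‖
  -- The radial derivative is, up to sign, e^{-κr} (1 + κr) / (4πr²), so the screening only improves
  -- on the Coulomb kernel.
  have hexp : Real.exp (-κ * r) * (1 + κ * r) ≤ 1 := by
    rw [neg_mul, Real.exp_neg, inv_mul_le_iff₀ (Real.exp_pos _), mul_one]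
    linarith [Real.add_one_le_exp (κ * r)]
  have hE : (Real.exp (-κ * r) * -κ * (4 * Real.pi * r) - Real.exp (-κ * r) * (4 * Real.pi))
      / (4 * Real.pi * r) ^ 2
      = -((Real.exp (-κ * r) * (1 + κ * r)) / (4 * Real.pi * r ^ 2)) := by
    field_simp; ring
  rw [hE, abs_neg, abs_of_pos (by positivity)]
  norm_num only [Nat.reduceSub]
  rw [div_le_div_iff₀ (by positivity) (by positivity)]
  nlinarith [sq_nonneg r, mul_le_mul_of_nonneg_right hexp (sq_nonneg r),
    mul_nonneg (sub_nonneg.2 hpi.le) (sq_nonneg r)]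

theorem measurable_gradient {d : ℕ} (K : Sp d → ℝ) : Measurable (gradient K) :=
  (LinearIsometryEquiv.continuous _).measurable.comp (measurable_fderiv ℝ K)

theorem one_lt_bExp (d : ℕ) : 1 < bExp d := by
  unfold bExp; split_ifs <;> norm_num

theorem bExp_mul_sub_one {d : ℕ} (hd : d = 2 ∨ d = 3) :
    (d : ℝ) * (1 / bExp d) = ((d - 1 : ℕ) : ℝ) := by
  rcases hd with rfl | rfl <;> norm_num [bExp]

/-- Up to the origin, where the kernel bound says nothing but which is a null set, {|∇K| > s} lies
in the ball of radius s^{-1/(d-1)}. Its volume is a multiple of s^{-d/(d-1)} = s^{-b}, by the choice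
of b. -/
theorem weakLpNorm_gradient_lt_top {d : ℕ} (hd : d = 2 ∨ d = 3) {K : Sp d → ℝ}
    (hK : ∀ x ≠ 0, ‖gradient K x‖ ≤ 1 / ‖x‖ ^ (d - 1)) :
    weakLpNorm (bExp d) (gradient K) < ∞ := by
  have hd1 : d - 1 ≠ 0 := by rcases hd with rfl | rfl <;> norm_num
  have hb : 0 < 1 / bExp d := one_div_pos.2 (zero_lt_one.trans (one_lt_bExp d))
  set V : ℝ≥0∞ := volume (Metric.ball (0 : Sp d) 1)
  have hV : V ^ (1 / bExp d) < ∞ :=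
    ENNReal.rpow_lt_top_of_nonneg hb.le measure_ball_lt_top.ne
  refine lt_of_le_of_lt (iSup_le fun s => ?_) hV
  rcases eq_or_ne s 0 with rfl | hs
  · simp
  have hs0 : (0 : ℝ) < s := by positivity
  set r : ℝ := (1 / (s : ℝ)) ^ (1 / ((d - 1 : ℕ) : ℝ)) with hr
  have hr0 : 0 < r := by positivity
  have hrp : r ^ (d - 1) = 1 / s := by
    rw [hr, one_div ((d - 1 : ℕ) : ℝ), Real.rpow_inv_natCast_pow (by positivity) hd1]
  have hsub : {x : Sp d | (s : ℝ≥0∞) < ‖gradient K x‖ₑ} ⊆ Metric.ball 0 r ∪ {0} := by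
    intro x hx
    rcases eq_or_ne x 0 with rfl | hx0
    · right; rfl
    left
    rw [mem_ofPred_eq, enorm_eq_nnnorm, ENNReal.coe_lt_coe] at hx
    have h1 : (s : ℝ) < ‖gradient K x‖ := by exact_mod_cast hx
    have h2 := h1.trans_le (hK x hx0)
    have hx1 : 0 < ‖x‖ := norm_pos_iff.2 hx0
    rw [mem_ball_zero_iff]
    refine lt_of_pow_lt_pow_left₀ (d - 1) hr0.le ?_
    rw [hrp, lt_div_iff₀ hs0]
    rwa [lt_div_iff₀ (by positivity), mul_comm] at h2
  have : Nonempty (Fin d) := ⟨⟨0, by rcases hd with rfl | rfl <;> norm_num⟩⟩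
  have hvol : volume {x : Sp d | (s : ℝ≥0∞) < ‖gradient K x‖ₑ} ≤ ENNReal.ofReal (r ^ d) * V := by
    calc _ ≤ volume (Metric.ball (0 : Sp d) r ∪ {0}) := measure_mono hsub
      _ ≤ volume (Metric.ball (0 : Sp d) r) + volume ({0} : Set (Sp d)) := measure_union_le _ _
      _ = ENNReal.ofReal (r ^ d) * V := by
        rw [measure_singleton, add_zero, Measure.addHaar_ball _ _ hr0.le]
        simp [V]
  calc (s : ℝ≥0∞) * _ ≤ s * (ENNReal.ofReal (r ^ d) * V) ^ (1 / bExp d) := by gcongr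
    _ = (s * ENNReal.ofReal (1 / s)) * V ^ (1 / bExp d) := by
      rw [ENNReal.mul_rpow_of_nonneg _ _ hb.le, ENNReal.ofReal_rpow_of_nonneg (by positivity) hb.le,
        ← Real.rpow_natCast, ← Real.rpow_mul hr0.le, bExp_mul_sub_one hd, Real.rpow_natCast, hrp,
        mul_assoc]
    _ = V ^ (1 / bExp d) := by
      rw [← ENNReal.ofReal_coe_nnreal, ← ENNReal.ofReal_mul hs0.le, mul_one_div_cancel hs0.ne',
        ENNReal.ofReal_one, one_mul]

/-! ### Hölder's inequality in Lorentz spaces -/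

theorem volume_superlevel_le {d : ℕ} {F : Type*} [NormedAddCommGroup F] {p : ℝ} (hp : 0 < p)
    {g : Sp d → F} {τ : ℝ} (hτ : 0 < τ) :
    volume {x : Sp d | ENNReal.ofReal τ < ‖g x‖ₑ} ≤ (weakLpNorm p g / ENNReal.ofReal τ) ^ p := by
  have h : ENNReal.ofReal τ * volume {x : Sp d | ENNReal.ofReal τ < ‖g x‖ₑ} ^ (1 / p)
      ≤ weakLpNorm p g :=
    le_iSup (fun s : ℝ≥0 => (s : ℝ≥0∞) * volume {x : Sp d | (s : ℝ≥0∞) < ‖g x‖ₑ} ^ (1 / p))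
      (Real.toNNReal τ)
  have h1 : volume {x : Sp d | ENNReal.ofReal τ < ‖g x‖ₑ} ^ (1 / p)
      ≤ weakLpNorm p g / ENNReal.ofReal τ := by
    rw [ENNReal.le_div_iff_mul_le (Or.inl (by simpa using hτ)) (Or.inl ENNReal.ofReal_ne_top),
      mul_comm]
    exact h
  calc _ = (volume {x : Sp d | ENNReal.ofReal τ < ‖g x‖ₑ} ^ (1 / p)) ^ p := by
        rw [← ENNReal.rpow_mul, one_div_mul_cancel hp.ne', ENNReal.rpow_one]
    _ ≤ _ := by gcongr

theorem lintegral_Ioi_div_rpow {N τ₀ b : ℝ} (hN : 0 < N) (hτ : 0 < τ₀) (hb : 1 < b) :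
    ∫⁻ τ in Ioi τ₀, (ENNReal.ofReal N / ENNReal.ofReal τ) ^ b
      = ENNReal.ofReal (N ^ b * (τ₀ ^ (1 - b) / (b - 1))) := by
  have h1 : ∫⁻ τ in Ioi τ₀, (ENNReal.ofReal N / ENNReal.ofReal τ) ^ b
      = ∫⁻ τ in Ioi τ₀, ENNReal.ofReal (N ^ b * τ ^ (-b)) := by
    refine setLIntegral_congr_fun measurableSet_Ioi fun τ hτ' => ?_
    have h0 : 0 < τ := hτ.trans hτ'
    rw [← ENNReal.ofReal_div_of_pos h0, ENNReal.ofReal_rpow_of_pos (by positivity),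
      Real.div_rpow hN.le h0.le, Real.rpow_neg h0.le, div_eq_mul_inv]
  rw [h1, ← ofReal_integral_eq_lintegral_ofReal, integral_const_mul,
    integral_Ioi_rpow_of_lt (by linarith) hτ]
  · congr 2
    rw [show -b + 1 = 1 - b by ring, ← neg_sub b 1, neg_div_neg_eq]
  · exact (integrableOn_Ioi_rpow_of_lt (by linarith) hτ).const_mul _
  · refine (ae_restrict_iff' measurableSet_Ioi).2 (.of_forall fun τ hτ' => ?_)
    have h0 : 0 < τ := hτ.trans hτ'
    simp only [Pi.zero_apply]
    positivity

/-- By the layer cake formula the integral over A is ∫ |A ∩ {|g| > τ}| dτ, and the integrand is at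
most both |A| and (N/τ)^b, with N the weak norm. The resulting constant is b', exactly the factor
built into `lorentzOneNorm`. -/
theorem setLIntegral_enorm_le_weakLpNorm {d : ℕ} {F : Type*} [NormedAddCommGroup F]
    [MeasurableSpace F] [BorelSpace F] {b : ℝ} (hb : 1 < b) {g : Sp d → F} (hg : Measurable g)
    (hN : weakLpNorm b g ≠ ∞) (A : Set (Sp d)) :
    ∫⁻ x in A, ‖g x‖ₑ ≤ ENNReal.ofReal (b / (b - 1)) * weakLpNorm b g
      * volume A ^ (1 / (b / (b - 1))) := by
  have hb0 : 0 < b := by linarith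
  have hb1 : 0 < b - 1 := by linarith
  have hlc : ∫⁻ x in A, ‖g x‖ₑ
      = ∫⁻ τ in Ioi (0 : ℝ), volume.restrict A {x | ENNReal.ofReal τ < ‖g x‖ₑ} := by
    have := lintegral_eq_lintegral_meas_lt (volume.restrict A) (f := fun x => ‖g x‖)
      (.of_forall fun _ => norm_nonneg _) hg.norm.aemeasurable
    simp only [ofReal_norm] at this
    rw [this]
    refine setLIntegral_congr_fun measurableSet_Ioi fun τ hτ => ?_
    congr 1; ext x
    simp only [mem_ofPred_eq, ← ofReal_norm]
    rw [ENNReal.ofReal_lt_ofReal_iff_of_nonneg (le_of_lt hτ)]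
  have hle : ∀ τ ∈ Ioi (0 : ℝ), volume.restrict A {x | ENNReal.ofReal τ < ‖g x‖ₑ}
      ≤ (weakLpNorm b g / ENNReal.ofReal τ) ^ b := fun τ hτ =>
    (Measure.restrict_apply_le _ _).trans (volume_superlevel_le hb0 hτ)
  have hle' : ∀ τ : ℝ, volume.restrict A {x | ENNReal.ofReal τ < ‖g x‖ₑ} ≤ volume A := fun τ =>
    (measure_mono (subset_univ _)).trans (by simp)
  rw [hlc]
  rcases eq_or_ne (weakLpNorm b g) 0 with h0 | h0
  · refine le_of_eq_of_le (setLIntegral_eq_zero measurableSet_Ioi fun τ hτ => ?_) zero_le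
    have := hle τ hτ
    rwa [h0, ENNReal.zero_div, ENNReal.zero_rpow_of_pos hb0, nonpos_iff_eq_zero] at this
  have hq : 0 < 1 / (b / (b - 1)) := by positivity
  rcases eq_or_ne (volume A) ∞ with hA | hA
  · rw [hA, ENNReal.top_rpow_of_pos hq, ENNReal.mul_top]
    · exact le_top
    · exact mul_ne_zero (by simp; positivity) h0
  rcases eq_or_ne (volume A) 0 with hA0 | hA0
  · refine le_of_eq_of_le (setLIntegral_eq_zero measurableSet_Ioi fun τ hτ => ?_) zero_le
    have := hle' τ
    rwa [hA0, nonpos_iff_eq_zero] at this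
  set N := (weakLpNorm b g).toReal with hNdef
  set a := (volume A).toReal with hadef
  have hN0 : 0 < N := ENNReal.toReal_pos h0 hN
  have ha0 : 0 < a := ENNReal.toReal_pos hA0 hA
  have hNe : weakLpNorm b g = ENNReal.ofReal N := (ENNReal.ofReal_toReal hN).symm
  have hae : volume A = ENNReal.ofReal a := (ENNReal.ofReal_toReal hA).symm
  -- The level at which the two bounds |A| and (N/τ)^b coincide.
  set τ₀ := N / a ^ (1 / b) with hτ₀
  have hτ0 : 0 < τ₀ := by positivity
  rw [← Ioc_union_Ioi_eq_Ioi hτ0.le, lintegral_union measurableSet_Ioi Ioc_disjoint_Ioi_same]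
  calc _ ≤ (∫⁻ _ in Ioc 0 τ₀, volume A)
        + ∫⁻ τ in Ioi τ₀, (weakLpNorm b g / ENNReal.ofReal τ) ^ b := by
        gcongr ?_ + ?_
        · exact lintegral_mono fun τ => hle' τ
        · exact setLIntegral_mono' measurableSet_Ioi fun τ hτ => hle τ (hτ0.trans hτ)
    _ = ENNReal.ofReal (a * τ₀ + N ^ b * (τ₀ ^ (1 - b) / (b - 1))) := by
        rw [hNe, lintegral_Ioi_div_rpow hN0 hτ0 hb, setLIntegral_const, Real.volume_Ioc, sub_zero,
          hae, ← ENNReal.ofReal_mul ha0.le, ← ENNReal.ofReal_add (by positivity) (by positivity)]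
    _ = _ := by
        rw [hNe, hae, ENNReal.ofReal_rpow_of_pos ha0, ← ENNReal.ofReal_mul (by positivity),
          ← ENNReal.ofReal_mul (by positivity)]
        congr 1
        have e1 : τ₀ ^ (1 - b) = N ^ (1 - b) * a ^ (1 - 1 / b) := by
          rw [hτ₀, Real.div_rpow hN0.le (by positivity), ← Real.rpow_mul ha0.le, div_eq_mul_inv,
            ← Real.rpow_neg ha0.le]
          congr 2; field_simp; ring
        have e2 : N ^ b * N ^ (1 - b) = N := by
          rw [← Real.rpow_add hN0]; simp
        have e3 : a * τ₀ = N * a ^ (1 - 1 / b) := by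
          rw [hτ₀, Real.rpow_sub ha0, Real.rpow_one]; ring
        have e4 : 1 / (b / (b - 1)) = 1 - 1 / b := by field_simp
        rw [e3, e1, e4, mul_div_assoc', ← mul_assoc, e2]
        field_simp; ring

/-- Hölder's inequality for the pair `(L^{b,∞}, L^{b',1})`, with constant one. -/
theorem lintegral_enorm_mul_le_weakLpNorm_mul_lorentzOneNorm {d : ℕ} {F : Type*}
    [NormedAddCommGroup F] [MeasurableSpace F] [BorelSpace F] {b : ℝ} (hb : 1 < b)
    {g : Sp d → F} (hg : Measurable g) (hN : weakLpNorm b g ≠ ∞) {h : Sp d → ℝ}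
    (hh : Measurable h) :
    ∫⁻ x, ‖h x‖ₑ * ‖g x‖ₑ ≤ weakLpNorm b g * lorentzOneNorm (b / (b - 1)) h := by
  -- Layer cake for h with respect to |g| dx: each superlevel set of h contributes the integral of
  -- |g| over it, to which the previous lemma applies.
  set ν : Measure (Sp d) := volume.withDensity fun x => ‖g x‖ₑ
  have h1 : ∫⁻ x, ‖h x‖ₑ * ‖g x‖ₑ = ∫⁻ x, ‖h x‖ₑ ∂ν := by
    rw [lintegral_withDensity_eq_lintegral_mul _ hg.enorm hh.enorm]
    exact lintegral_congr fun x => mul_comm _ _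
  have h2 : ∫⁻ x, ‖h x‖ₑ ∂ν = ∫⁻ s in Ioi (0 : ℝ), ν {x | ENNReal.ofReal s < ‖h x‖ₑ} := by
    have := lintegral_eq_lintegral_meas_lt ν (f := fun x => ‖h x‖)
      (.of_forall fun _ => norm_nonneg _) hh.norm.aemeasurable
    simp only [ofReal_norm] at this
    rw [this]
    refine setLIntegral_congr_fun measurableSet_Ioi fun τ hτ => ?_
    congr 1; ext x
    simp only [mem_ofPred_eq, ← ofReal_norm]
    rw [ENNReal.ofReal_lt_ofReal_iff_of_nonneg (le_of_lt hτ)]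
  rw [h1, h2]
  calc _ ≤ ∫⁻ s in Ioi (0 : ℝ), ENNReal.ofReal (b / (b - 1)) * weakLpNorm b g
        * volume {x | ENNReal.ofReal s < ‖h x‖ₑ} ^ (1 / (b / (b - 1))) := by
        refine lintegral_mono fun s => ?_
        rw [withDensity_apply _ (measurableSet_lt measurable_const hh.enorm)]
        exact setLIntegral_enorm_le_weakLpNorm hb hg hN _
    _ = _ := by
        rw [lintegral_const_mul' _ _ (ENNReal.mul_ne_top ENNReal.ofReal_ne_top hN), lorentzOneNorm]
        ring

/-! ### Classical solutions along straight lines of phase space -/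

/-- The acceleration F is frozen: the curve is a straight line that agrees to first order with a
characteristic, and no differential equation has to be solved. -/
theorem hasDerivAt_comp_line {d : ℕ} {G : Type*} [NormedAddCommGroup G] [NormedSpace ℝ G]
    {U : ℝ × Sp d × Sp d → G} {t : ℝ} {x v : Sp d} (hU : DifferentiableAt ℝ U (t, x, v))
    (F : Sp d) :
    HasDerivAt (fun s : ℝ => U (t + s, x + s • v, v - s • F)) (fderiv ℝ U (t, x, v) (1, v, -F)) 0 := by
  have h1 : HasDerivAt (fun s : ℝ => t + s) 1 0 := (hasDerivAt_id (0 : ℝ)).const_add t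
  have h2 : HasDerivAt (fun s : ℝ => x + s • v) v 0 := by
    simpa using ((hasDerivAt_id (0 : ℝ)).smul_const v).const_add x
  have h3 : HasDerivAt (fun s : ℝ => v - s • F) (-F) 0 := by
    simpa using ((hasDerivAt_id (0 : ℝ)).smul_const F).const_sub v
  have h4 : HasDerivAt (fun s : ℝ => (t + s, x + s • v, v - s • F)) (1, v, -F) 0 :=
    h1.prodMk (h2.prodMk h3)
  have hU' : HasFDerivAt U (fderiv ℝ U (t, x, v)) (t + 0, x + (0 : ℝ) • v, v - (0 : ℝ) • F) := by
    simpa using hU.hasFDerivAt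
  exact hU'.comp_hasDerivAt 0 h4

theorem hasDerivAt_norm_sq_line {d : ℕ} (x v F : Sp d) :
    HasDerivAt (fun s : ℝ => 1 + ‖x + s • v‖ ^ 2 + ‖v - s • F‖ ^ 2)
      (2 * inner ℝ x v - 2 * inner ℝ v F) 0 := by
  have h2 : HasDerivAt (fun s : ℝ => x + s • v) v 0 := by
    simpa using ((hasDerivAt_id (0 : ℝ)).smul_const v).const_add x
  have h3 : HasDerivAt (fun s : ℝ => v - s • F) (-F) 0 := by
    simpa using ((hasDerivAt_id (0 : ℝ)).smul_const F).const_sub v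
  have := (h2.norm_sq.const_add 1).add h3.norm_sq
  exact this.congr_deriv (by simp [inner_neg_right, sub_eq_add_neg])

/-- The magnetic part does no work, so only E enters, and its linear growth makes x·v and v·E
quadratic. This is the source of every penalty and cutoff below. -/
theorem abs_transport_norm_sq_le {d : ℕ} {A : ℝ} {x v E F : Sp d} (hA : 0 ≤ A)
    (hE : ‖E‖ ≤ A * (1 + ‖x‖)) (hF : inner ℝ v F = inner ℝ v E) :
    |2 * inner ℝ x v - 2 * inner ℝ v F| ≤ (1 + 2 * A) * (1 + ‖x‖ ^ 2 + ‖v‖ ^ 2) := by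
  have h1 : |inner ℝ x v| ≤ ‖x‖ * ‖v‖ := abs_real_inner_le_norm x v
  have h2 : |inner ℝ v E| ≤ ‖v‖ * (A * (1 + ‖x‖)) :=
    (abs_real_inner_le_norm v E).trans (by gcongr)
  rw [hF]
  calc _ ≤ |2 * inner ℝ x v| + |2 * inner ℝ v E| := abs_sub _ _
    _ = 2 * |inner ℝ x v| + 2 * |inner ℝ v E| := by rw [abs_mul, abs_mul]; norm_num
    _ ≤ 2 * (‖x‖ * ‖v‖) + 2 * (‖v‖ * (A * (1 + ‖x‖))) := by gcongr
    _ ≤ _ := by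
      nlinarith [sq_nonneg (‖x‖ - ‖v‖), mul_nonneg hA (sq_nonneg (1 - ‖x‖)),
        mul_nonneg hA (sq_nonneg (1 + ‖x‖ - ‖v‖)), sq_nonneg ‖x‖]

/-- The total acceleration `∇K ⋆ ρ_f + v ∧ B`. -/
noncomputable def force {d : ℕ} (K : Sp d → ℝ) (wB : ℝ → Sp d → Sp d → Sp d)
    (f : ℝ → Sp d → Sp d → ℝ) (t : ℝ) (x v : Sp d) : Sp d :=
  gradConv K (density (f t)) x + wB t x v

namespace IsClassicalSolution

variable {d : ℕ} {K : Sp d → ℝ} {wB : ℝ → Sp d → Sp d → Sp d} {T : ℝ}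
  {fin : Sp d → Sp d → ℝ} {f : ℝ → Sp d → Sp d → ℝ}

theorem differentiableAt (hf : IsClassicalSolution K wB T fin f) {t : ℝ} (ht : t ∈ Ioo 0 T)
    (x v : Sp d) :
    DifferentiableAt ℝ (fun z : ℝ × Sp d × Sp d => f z.1 z.2.1 z.2.2) (t, x, v) :=
  (hf.contDiffOn.differentiableOn (by norm_num)).differentiableAt
    ((isOpen_Ioo.prod isOpen_univ).mem_nhds ⟨ht, mem_univ _⟩)

theorem fderiv_transport (hf : IsClassicalSolution K wB T fin f) {t : ℝ} (ht : t ∈ Ioo 0 T)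
    (x v : Sp d) :
    fderiv ℝ (fun z : ℝ × Sp d × Sp d => f z.1 z.2.1 z.2.2) (t, x, v)
      (1, v, -force K wB f t x v) = 0 := by
  have hd := (hf.differentiableAt ht x v).hasFDerivAt
  set L := fderiv ℝ (fun z : ℝ × Sp d × Sp d => f z.1 z.2.1 z.2.2) (t, x, v)
  have h1 : deriv (fun s => f s x v) t = L (1, 0, 0) := by
    have : HasDerivAt (fun s : ℝ => (s, x, v)) ((1 : ℝ), (0 : Sp d), (0 : Sp d)) t :=
      (hasDerivAt_id t).prodMk ((hasDerivAt_const t x).prodMk (hasDerivAt_const t v))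
    exact (hd.comp_hasDerivAt t this).deriv
  have h2 : inner ℝ v (gradient (fun y => f t y v) x) = L (0, v, 0) := by
    have : HasFDerivAt (fun y : Sp d => (t, y, v))
        ((0 : Sp d →L[ℝ] ℝ).prod ((ContinuousLinearMap.id ℝ (Sp d)).prod 0)) x :=
      (hasFDerivAt_const t x).prodMk ((hasFDerivAt_id x).prodMk (hasFDerivAt_const v x))
    have h := (hd.comp x this).fderiv
    rw [inner_gradient_right, conj_trivial]
    change fderiv ℝ ((fun z : ℝ × Sp d × Sp d => f z.1 z.2.1 z.2.2) ∘ fun y => (t, y, v)) x v = _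
    rw [h]; simp
  have h3 : inner ℝ (force K wB f t x v) (gradient (fun w => f t x w) v)
      = L (0, 0, force K wB f t x v) := by
    have : HasFDerivAt (fun w : Sp d => (t, x, w))
        ((0 : Sp d →L[ℝ] ℝ).prod ((0 : Sp d →L[ℝ] Sp d).prod (ContinuousLinearMap.id ℝ (Sp d)))) v :=
      (hasFDerivAt_const t v).prodMk ((hasFDerivAt_const x v).prodMk (hasFDerivAt_id v))
    have h := (hd.comp v this).fderiv
    rw [inner_gradient_right, conj_trivial]
    change fderiv ℝ ((fun z : ℝ × Sp d × Sp d => f z.1 z.2.1 z.2.2) ∘ fun w => (t, x, w)) v _ = _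
    rw [h]; simp
  have h4 := hf.equation t ht x v
  rw [h1, h2, ← force, h3] at h4
  rw [← h4, ← map_add, ← map_sub]
  simp

theorem hasDerivAt_line (hf : IsClassicalSolution K wB T fin f) {t : ℝ} (ht : t ∈ Ioo 0 T)
    (x v : Sp d) :
    HasDerivAt (fun s : ℝ => f (t + s) (x + s • v) (v - s • force K wB f t x v)) 0 0 := by
  simpa [hf.fderiv_transport ht x v] using
    hasDerivAt_comp_line (hf.differentiableAt ht x v) (force K wB f t x v)

theorem continuous_slice (hf : IsClassicalSolution K wB T fin f) {t : ℝ} (ht : t ∈ Icc 0 T) :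
    Continuous (fun z : Sp d × Sp d => f t z.1 z.2) := by
  have h := hf.continuousOn.comp_continuous (f := fun z : Sp d × Sp d => (t, z.1, z.2))
    (by fun_prop) (fun z => ⟨ht, mem_univ _⟩)
  exact h

theorem exists_field_growth (hf : IsClassicalSolution K wB T fin f) :
    ∃ A : ℝ, 0 ≤ A ∧ ∀ t ∈ Icc 0 T, ∀ x, ‖gradConv K (density (f t)) x‖ ≤ A * (1 + ‖x‖) := by
  obtain ⟨A, hA⟩ := hf.field_growth
  refine ⟨max A 0, le_max_right _ _, fun t ht x => (hA t ht x).trans ?_⟩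
  gcongr
  exact le_max_left _ _

end IsClassicalSolution

/-- A superlevel set of a continuous function is open, and an open null set is empty. -/
theorem norm_le_of_eLpNorm_top_le {X : Type*} [TopologicalSpace X] [MeasurableSpace X]
    [OpensMeasurableSpace X] {μ : Measure X} [μ.IsOpenPosMeasure] {g : X → ℝ} (hg : Continuous g)
    {c : ℝ} (hc : 0 ≤ c) (h : eLpNorm g ∞ μ ≤ ENNReal.ofReal c) (x : X) : ‖g x‖ ≤ c := by
  have h1 : ∀ᵐ y ∂μ, ‖g y‖ ≤ c := by
    filter_upwards [ae_le_eLpNormEssSup (f := g) (μ := μ)] with y hy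
    rw [eLpNorm_exponent_top] at h
    have := hy.trans h
    rwa [← ofReal_norm, ENNReal.ofReal_le_ofReal_iff hc] at this
  by_contra! hx
  have ho : IsOpen {y | c < ‖g y‖} := isOpen_lt continuous_const hg.norm
  have hz : μ {y | c < ‖g y‖} = 0 := by
    rw [ae_iff] at h1
    simpa using h1
  exact (Set.eq_empty_iff_forall_notMem.1 ((ho.measure_eq_zero_iff μ).1 hz)) x hx

namespace IsClassicalSolution

variable {d : ℕ} {K : Sp d → ℝ} {wB : ℝ → Sp d → Sp d → Sp d} {T : ℝ}
  {fin : Sp d → Sp d → ℝ} {f : ℝ → Sp d → Sp d → ℝ}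

theorem exists_bound (hf : IsClassicalSolution K wB T fin f) :
    ∃ A : ℝ, 0 ≤ A ∧ (∀ t ∈ Icc 0 T, ∀ x v, f t x v ≤ A)
      ∧ ∀ t ∈ Icc 0 T, phaseNorm 1 (f t) ≤ ENNReal.ofReal A := by
  obtain ⟨A, hA⟩ := hf.bounded
  refine ⟨A, A.2, fun t ht x v => ?_, fun t ht => by simpa using (hA t ht).1⟩
  have := norm_le_of_eLpNorm_top_le (hf.continuous_slice ht) A.2
    (by simpa [phaseNorm] using (hA t ht).2) (x, v)
  exact (le_abs_self _).trans this

end IsClassicalSolution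

/-! ### The maximum principle -/

/-- Only earlier points are compared, so the criterion applies also when the maximum sits at the
last time of a slab. -/
theorem nonneg_of_hasDerivAt_of_le_left {g : ℝ → ℝ} {g' a : ℝ} (hg : HasDerivAt g g' 0)
    (ha : a < 0) (hmax : ∀ s ∈ Ioo a 0, g s ≤ g 0) : 0 ≤ g' := by
  have h1 : Tendsto (slope g 0) (𝓝[<] 0) (𝓝 g') :=
    (hasDerivAt_iff_tendsto_slope.1 hg).mono_left (nhdsWithin_mono _ fun s hs => ne_of_lt hs)
  refine ge_of_tendsto h1 ?_
  filter_upwards [Ioo_mem_nhdsLT ha] with s hs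
  rw [slope_def_field, sub_zero]
  exact div_nonneg_of_nonpos (sub_nonpos.2 (hmax s hs)) hs.2.le

/-- A weight `W ≥ 0` of polynomial growth whose transport derivative is at most `lam * W`
satisfies `f W ≤ C₀ e^{lam (t - t₀)}` if this holds at the time `t₀`. No regularity of the
force is needed, since at a maximum only the derivative along one straight line matters. -/
theorem IsClassicalSolution.mul_weight_le {d : ℕ} {K : Sp d → ℝ} {wB : ℝ → Sp d → Sp d → Sp d}
    {T : ℝ} {fin : Sp d → Sp d → ℝ} {f : ℝ → Sp d → Sp d → ℝ}
    (hf : IsClassicalSolution K wB T fin f) (hw : ∀ t x v, inner ℝ v (wB t x v) = 0)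
    {t₀ t₁ : ℝ} (h0 : 0 ≤ t₀) (h1 : t₁ ≤ T) {W : ℝ → Sp d → Sp d → ℝ}
    (hWc : ContinuousOn (fun z : ℝ × Sp d × Sp d => W z.1 z.2.1 z.2.2) (Icc t₀ t₁ ×ˢ univ))
    (hWp : ∀ t ∈ Icc t₀ t₁, ∀ x v, 0 ≤ W t x v) {CW : ℝ} {N : ℕ}
    (hWg : ∀ t ∈ Icc t₀ t₁, ∀ x v, W t x v ≤ CW * (1 + ‖x‖ ^ 2 + ‖v‖ ^ 2) ^ N)
    {lam C₀ : ℝ} (hC₀ : 0 ≤ C₀)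
    (hD : ∀ t ∈ Ioo t₀ t₁, ∀ x v, ∃ w',
      HasDerivAt (fun s : ℝ => W (t + s) (x + s • v) (v - s • force K wB f t x v)) w' 0
        ∧ w' ≤ lam * W t x v)
    (hini : ∀ x v, f t₀ x v * W t₀ x v ≤ C₀) :
    ∀ t ∈ Icc t₀ t₁, ∀ x v, f t x v * W t x v ≤ C₀ * Real.exp (lam * (t - t₀)) := by
  obtain ⟨A, hA, hgrow⟩ := hf.exists_field_growth
  obtain ⟨B, hB, hfB, -⟩ := hf.exists_bound
  have hsub : Icc t₀ t₁ ⊆ Icc 0 T := Icc_subset_Icc h0 h1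
  -- With m = 1 + |x|² + |v|², the transport can decrease m^{N+1} at rate at most (N+1)(1+2A). The
  -- extra 1 makes the transport derivative of e^{Ct} m^{N+1} strictly positive.
  set C : ℝ := (N + 1) * (1 + 2 * A) + 1 with hC
  -- the penalized statement
  have key : ∀ ε > 0, ∀ t₂ ∈ Ico t₀ t₁, ∀ x v,
      f t₂ x v * W t₂ x v * Real.exp (-(lam * (t₂ - t₀)))
        - ε * (Real.exp (C * (t₂ - t₀)) * (1 + ‖x‖ ^ 2 + ‖v‖ ^ 2) ^ (N + 1)) ≤ C₀ := by
    intro ε hε t₂ ht₂ x₁ v₁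
    by_contra! hcon
    set h : ℝ × Sp d × Sp d → ℝ := fun z =>
      f z.1 z.2.1 z.2.2 * W z.1 z.2.1 z.2.2 * Real.exp (-(lam * (z.1 - t₀)))
        - ε * (Real.exp (C * (z.1 - t₀)) * (1 + ‖z.2.1‖ ^ 2 + ‖z.2.2‖ ^ 2) ^ (N + 1)) with hh
    set S : Set (ℝ × Sp d × Sp d) := Icc t₀ t₂ ×ˢ univ
    have hS1 : S ⊆ Icc t₀ t₁ ×ˢ univ := prod_mono (Icc_subset_Icc le_rfl ht₂.2.le) subset_rfl
    have hS0 : S ⊆ Icc 0 T ×ˢ univ := hS1.trans (prod_mono hsub subset_rfl)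
    have hcont : ContinuousOn h S := by
      refine ((hf.continuousOn.mono hS0).mul (hWc.mono hS1)).mul ?_ |>.sub ?_
      · exact Continuous.continuousOn (by fun_prop)
      · exact Continuous.continuousOn (by fun_prop)
    have hz1 : (t₂, x₁, v₁) ∈ S := ⟨⟨ht₂.1, le_rfl⟩, mem_univ _⟩
    set Lc : ℝ := B * |CW| * Real.exp (|lam| * (t₁ - t₀)) with hLc
    have hLc0 : 0 ≤ Lc := by positivity
    -- The first term of the penalized function is at most Lc m^N. If |x| or |v| exceeds R, then ε m
    -- ≥ Lc, so the penalty wins and the maximum is attained in a compact set.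
    set R : ℝ := Lc / ε + 1
    have hR1 : 1 ≤ R := by
      have : 0 ≤ Lc / ε := by positivity
      simp only [R]; linarith
    have hfar : ∀ z ∈ S, z ∉ Icc t₀ t₂ ×ˢ (Metric.closedBall (0 : Sp d) R ×ˢ
        Metric.closedBall (0 : Sp d) R) → h z ≤ C₀ := by
      rintro ⟨t, x, v⟩ ⟨ht, -⟩ hz
      simp only at ht
      have ht1 : t ∈ Icc t₀ t₁ := ⟨ht.1, ht.2.trans ht₂.2.le⟩
      set m : ℝ := 1 + ‖x‖ ^ 2 + ‖v‖ ^ 2 with hm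
      have hm1 : 1 ≤ m := by rw [hm]; nlinarith [sq_nonneg ‖x‖, sq_nonneg ‖v‖]
      have hmR : R ≤ m := by
        have : R < ‖x‖ ∨ R < ‖v‖ := by
          by_contra! hcc
          exact hz ⟨ht, by simpa using hcc.1, by simpa using hcc.2⟩
        rcases this with h' | h' <;> rw [hm] <;> nlinarith [sq_nonneg ‖x‖, sq_nonneg ‖v‖]
      have hLm : Lc ≤ ε * m := by
        have : Lc / ε ≤ m := le_trans (by simp [R]) hmR
        rwa [div_le_iff₀ hε, mul_comm] at this
      have e1 : f t x v * W t x v * Real.exp (-(lam * (t - t₀))) ≤ Lc * m ^ N := by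
        have hW0 := hWp t ht1 x v
        have a1 : W t x v ≤ |CW| * m ^ N := (hWg t ht1 x v).trans (by gcongr; exact le_abs_self _)
        have a2 : Real.exp (-(lam * (t - t₀))) ≤ Real.exp (|lam| * (t₁ - t₀)) := by
          refine Real.exp_le_exp.2 ?_
          have b1 : -lam * (t - t₀) ≤ |lam| * (t - t₀) :=
            mul_le_mul_of_nonneg_right (neg_le_abs _) (by linarith [ht.1])
          have b2 : |lam| * (t - t₀) ≤ |lam| * (t₁ - t₀) := by
            gcongr; exact ht1.2
          linarith
        calc _ ≤ B * (|CW| * m ^ N) * Real.exp (|lam| * (t₁ - t₀)) := by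
              gcongr
              exact hfB t (hsub ht1) x v
          _ = _ := by rw [hLc]; ring
      have e2 : 1 ≤ Real.exp (C * (t - t₀)) :=
        Real.one_le_exp (mul_nonneg (by positivity) (by linarith [ht.1]))
      have e3 : Lc * m ^ N ≤ ε * (Real.exp (C * (t - t₀)) * m ^ (N + 1)) := by
        calc Lc * m ^ N ≤ ε * m * m ^ N := by gcongr
          _ = ε * (1 * m ^ (N + 1)) := by ring
          _ ≤ _ := by gcongr
      simp only [hh]
      linarith
    obtain ⟨⟨t, x, v⟩, hzS, hzmax⟩ := hcont.exists_isMaxOn' (isClosed_Icc.prod isClosed_univ) hz1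
      (by
        rw [eventually_inf_principal]
        have hcpt : IsCompact (Icc t₀ t₂ ×ˢ (Metric.closedBall (0 : Sp d) R ×ˢ
            Metric.closedBall (0 : Sp d) R)) :=
          isCompact_Icc.prod ((isCompact_closedBall _ _).prod (isCompact_closedBall _ _))
        filter_upwards [hcpt.compl_mem_cocompact] with z hz hzS
        exact (hfar z hzS hz).trans hcon.le)
    have hzgt : C₀ < h (t, x, v) := hcon.trans_le (hzmax hz1)
    have ht : t ∈ Icc t₀ t₂ := hzS.1
    have hm0 : 0 < 1 + ‖x‖ ^ 2 + ‖v‖ ^ 2 := by positivity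
    have htne : t ≠ t₀ := by
      rintro rfl
      have := hini x v
      simp only [hh, sub_self, mul_zero, neg_zero, Real.exp_zero, mul_one, one_mul] at hzgt
      have : 0 ≤ ε * (1 + ‖x‖ ^ 2 + ‖v‖ ^ 2) ^ (N + 1) := by positivity
      linarith
    have htt : t ∈ Ioo t₀ t₁ := ⟨lt_of_le_of_ne ht.1 htne.symm, ht.2.trans_lt ht₂.2⟩
    have ht0T : t ∈ Ioo 0 T := ⟨h0.trans_lt htt.1, htt.2.trans_le h1⟩
    obtain ⟨w', hw', hw'le⟩ := hD t htt x v
    set F := force K wB f t x v with hF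
    have hFE : inner ℝ v F = inner ℝ v (gradConv K (density (f t)) x) := by
      rw [hF, force, inner_add_right, hw, add_zero]
    have hq := abs_transport_norm_sq_le hA (hgrow t ⟨ht0T.1.le, ht0T.2.le⟩ x) hFE
    set q' := 2 * inner ℝ x v - 2 * inner ℝ v F
    have d1 : HasDerivAt (fun s : ℝ => t + s - t₀) 1 0 :=
      ((hasDerivAt_id (0 : ℝ)).const_add t).sub_const t₀
    have d2 := ((hf.hasDerivAt_line ht0T x v).mul hw').mul (d1.const_mul lam).neg.exp
    have d3 := (((d1.const_mul C).exp).mul ((hasDerivAt_norm_sq_line x v F).pow (N + 1))).const_mul ε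
    -- Going backwards from the maximum along (1, v, -F) remains in the slab, so the derivative
    -- there is nonnegative. The bounds `p1` and `p3` show that it is negative.
    have hder := nonneg_of_hasDerivAt_of_le_left (d2.sub d3) (a := t₀ - t) (by linarith [htt.1])
      (by
        intro s hs
        have hmem : (t + s, x + s • v, v - s • F) ∈ S :=
          ⟨⟨by linarith [hs.1], by linarith [hs.2, ht.2]⟩, mem_univ _⟩
        have := hzmax hmem
        simpa [hh] using this)
    simp only [add_zero, zero_smul, sub_zero, zero_mul, zero_add, mul_one, Nat.add_sub_cancel,
      Pi.pow_apply, Pi.mul_apply, Pi.neg_apply] at hder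
    have hfnn := hf.nonneg t ⟨ht0T.1.le, ht0T.2.le⟩ x v
    set m := 1 + ‖x‖ ^ 2 + ‖v‖ ^ 2
    have p1 : f t x v * w' * Real.exp (-(lam * (t - t₀))) + f t x v * W t x v *
        (Real.exp (-(lam * (t - t₀))) * -lam) ≤ 0 := by
      have : f t x v * w' ≤ f t x v * (lam * W t x v) := by gcongr
      have := mul_le_mul_of_nonneg_right this (Real.exp_pos (-(lam * (t - t₀)))).le
      linarith
    have p2 : 0 < C * m ^ (N + 1) + (N + 1) * m ^ N * q' := by
      have : -((1 + 2 * A) * m) ≤ q' := (abs_le.1 hq).1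
      have h3 : (N + 1) * m ^ N * -((1 + 2 * A) * m) ≤ (N + 1) * m ^ N * q' := by gcongr
      have h4 : 0 < m ^ (N + 1) := by positivity
      rw [hC]
      have h5 : (N + 1 : ℝ) * m ^ N * -((1 + 2 * A) * m)
        = -((N + 1) * (1 + 2 * A) * m ^ (N + 1)) := by ring
      nlinarith
    have p3 : 0 < ε * (Real.exp (C * (t - t₀)) * (C * m ^ (N + 1) + (N + 1) * m ^ N * q')) := by
      positivity
    push_cast at hder
    linarith
  have hIco : ∀ t ∈ Ico t₀ t₁, ∀ x v, f t x v * W t x v ≤ C₀ * Real.exp (lam * (t - t₀)) := by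
    intro t ht x v
    have hlim : f t x v * W t x v * Real.exp (-(lam * (t - t₀))) ≤ C₀ := by
      refine le_of_forall_pos_le_add fun δ hδ => ?_
      set M := Real.exp (C * (t - t₀)) * (1 + ‖x‖ ^ 2 + ‖v‖ ^ 2) ^ (N + 1)
      have hM : 0 < M := by positivity
      have := key (δ / M) (by positivity) t ht x v
      rw [div_mul_cancel₀ _ hM.ne'] at this
      linarith
    rw [Real.exp_neg, ← div_eq_mul_inv, div_le_iff₀ (Real.exp_pos _)] at hlim
    exact hlim
  intro t ht x v
  rcases eq_or_lt_of_le (ht.1.trans ht.2) with h01 | h01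
  · have : t = t₀ := le_antisymm (ht.2.trans h01.ge) ht.1
    subst this
    simpa using hini x v
  -- The equation is available only at interior times, so the final time is reached by continuity.
  have hcl : closure (Ico t₀ t₁) = Icc t₀ t₁ := closure_Ico h01.ne
  refine le_on_closure (s := Ico t₀ t₁) (f := fun t => f t x v * W t x v)
    (g := fun t => C₀ * Real.exp (lam * (t - t₀))) (fun t ht => hIco t ht x v) ?_
    (Continuous.continuousOn (by fun_prop)) (hcl ▸ ht)
  rw [hcl]
  have hline : ContinuousOn (fun t : ℝ => (t, x, v)) (Icc t₀ t₁) :=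
    Continuous.continuousOn (by fun_prop)
  exact (hf.continuousOn.comp hline fun t ht => ⟨hsub ht, mem_univ _⟩).mul
    (hWc.comp hline fun t ht => ⟨ht, mem_univ _⟩)

/-! ### Density and field of a classical solution -/

/-- The majorant `∫ |ρ(y)| |∇K(x - y)| dy` of the field. -/
noncomputable def fieldMajorant {d : ℕ} (K ρ : Sp d → ℝ) (x : Sp d) : ℝ≥0∞ :=
  ∫⁻ y, ‖ρ y‖ₑ * ‖gradient K (x - y)‖ₑ

theorem enorm_gradConv_le {d : ℕ} (K ρ : Sp d → ℝ) (x : Sp d) :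
    ‖gradConv K ρ x‖ₑ ≤ fieldMajorant K ρ x := by
  refine (enorm_integral_le_lintegral_enorm _).trans (le_of_eq ?_)
  simp only [enorm_smul, fieldMajorant]

theorem fieldMajorant_le_weak {d : ℕ} {b : ℝ} (hb : 1 < b) {K ρ : Sp d → ℝ}
    (hN : weakLpNorm b (gradient K) ≠ ∞) (hρ : Measurable ρ) (x : Sp d) :
    fieldMajorant K ρ x ≤ weakLpNorm b (gradient K) * lorentzOneNorm (b / (b - 1)) ρ := by
  have hmp : MeasurePreserving (fun y : Sp d => x - y) volume volume :=
    Measure.measurePreserving_sub_left volume x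
  have hme : MeasurableEmbedding (fun y : Sp d => x - y) :=
    (Homeomorph.subLeft x).measurableEmbedding
  have he : weakLpNorm b (fun y => gradient K (x - y)) = weakLpNorm b (gradient K) := by
    unfold weakLpNorm
    congr 1; ext s; congr 2
    exact hmp.measure_preimage_emb hme {x | (s : ℝ≥0∞) < ‖gradient K x‖ₑ}
  rw [← he] at hN ⊢
  exact lintegral_enorm_mul_le_weakLpNorm_mul_lorentzOneNorm hb
    ((measurable_gradient K).comp (measurable_const.sub measurable_id)) hN hρ

theorem fieldMajorant_le_eLpNorm {d : ℕ} {b : ℝ} (hb : 1 < b) {K ρ : Sp d → ℝ}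
    (hρ : Measurable ρ) (x : Sp d) :
    fieldMajorant K ρ x ≤ eLpNorm (gradient K) (ENNReal.ofReal b) volume
      * eLpNorm ρ (ENNReal.ofReal (b / (b - 1))) volume := by
  have hmp : MeasurePreserving (fun y : Sp d => x - y) volume volume :=
    Measure.measurePreserving_sub_left volume x
  have he : eLpNorm (fun y => gradient K (x - y)) (ENNReal.ofReal b) volume
      = eLpNorm (gradient K) (ENNReal.ofReal b) volume :=
    eLpNorm_comp_measurePreserving (measurable_gradient K).aestronglyMeasurable hmp
  have hb0 : 0 < b := by linarith
  have hb' : 0 < b / (b - 1) := div_pos hb0 (by linarith)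
  have hconj : b.HolderConjugate (b / (b - 1)) := Real.HolderConjugate.conjExponent hb
  rw [← he, mul_comm, eLpNorm_eq_lintegral_rpow_enorm_toReal (by simpa using hb')
    ENNReal.ofReal_ne_top, eLpNorm_eq_lintegral_rpow_enorm_toReal (by simpa using hb0)
    ENNReal.ofReal_ne_top, ENNReal.toReal_ofReal hb0.le, ENNReal.toReal_ofReal hb'.le]
  exact ENNReal.lintegral_mul_le_Lp_mul_Lq volume hconj.symm hρ.enorm.aemeasurable
    ((measurable_gradient K).comp (measurable_const.sub measurable_id)).enorm.aemeasurable

/-- Sets of full measure in a nondegenerate interval are dense. This lets a bound by an essential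
supremum in time be carried to every time. -/
theorem mem_closure_of_ae_restrict_Icc {T : ℝ} (hT : 0 < T) {P : ℝ → Prop}
    (hP : ∀ᵐ s ∂volume.restrict (Icc 0 T), P s) {t : ℝ} (ht : t ∈ Icc 0 T) :
    t ∈ closure {s | s ∈ Icc 0 T ∧ P s} := by
  rw [Metric.mem_closure_iff]
  intro ε hε
  rw [ae_restrict_iff' measurableSet_Icc] at hP
  have hlt : max 0 (t - ε) < min T (t + ε) := by
    have := ht.1; have := ht.2
    refine max_lt (lt_min hT (by linarith)) (lt_min (by linarith) (by linarith))
  have hpos : volume (Ioo (max 0 (t - ε)) (min T (t + ε))) ≠ 0 := by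
    rw [Real.volume_Ioo, ne_eq, ENNReal.ofReal_eq_zero, not_le]
    linarith
  obtain ⟨s, hs, hPs⟩ : ∃ s ∈ Ioo (max 0 (t - ε)) (min T (t + ε)), s ∈ Icc 0 T → P s := by
    by_contra! hcon
    refine hpos (measure_mono_null (fun s hs => ?_) (ae_iff.1 hP))
    have := hcon s hs
    simpa [and_assoc] using this
  have h1 := (max_lt_iff.1 hs.1)
  have h2 := (lt_min_iff.1 hs.2)
  have hsI : s ∈ Icc 0 T := ⟨h1.1.le, h2.1.le⟩
  refine ⟨s, ⟨hsI, hPs hsI⟩, ?_⟩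
  rw [Real.dist_eq, abs_lt]
  constructor <;> linarith [h1.2, h2.2]

theorem integrable_one_div_one_add_norm_pow {d n : ℕ} (hn : d < n) :
    Integrable (fun v : Sp d => 1 / (1 + ‖v‖ ^ n)) := by
  have h := (integrable_one_add_norm (E := Sp d) (μ := volume) (r := n)
    (by simpa using hn)).const_mul (2 ^ (n - 1))
  refine h.mono' (Continuous.aestronglyMeasurable ?_) (.of_forall fun v => ?_)
  · exact Continuous.div (by fun_prop) (by fun_prop) fun v => by positivity
  · rw [Real.norm_of_nonneg (by positivity), Real.rpow_neg (by positivity), Real.rpow_natCast,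
      ← div_eq_mul_inv, div_le_div_iff₀ (by positivity) (by positivity), one_mul]
    simpa using add_pow_le (zero_le_one) (norm_nonneg v) n

namespace IsClassicalSolution

variable {d : ℕ} {K : Sp d → ℝ} {wB : ℝ → Sp d → Sp d → Sp d} {T : ℝ}
  {fin : Sp d → Sp d → ℝ} {f : ℝ → Sp d → Sp d → ℝ}

theorem density_nonneg (hf : IsClassicalSolution K wB T fin f) {t : ℝ} (ht : t ∈ Icc 0 T)
    (x : Sp d) : 0 ≤ density (f t) x :=
  integral_nonneg fun v => hf.nonneg t ht x v

theorem enorm_density (hf : IsClassicalSolution K wB T fin f) {t : ℝ} (ht : t ∈ Icc 0 T)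
    (x : Sp d) : ‖density (f t) x‖ₑ = ∫⁻ v, ENNReal.ofReal (f t x v) := by
  rw [Real.enorm_of_nonneg (hf.density_nonneg ht x), density,
    ofReal_integral_eq_lintegral_ofReal (hf.density_exists t ht x)
      (.of_forall fun v => hf.nonneg t ht x v)]

theorem measurable_density (hf : IsClassicalSolution K wB T fin f) {t : ℝ} (ht : t ∈ Icc 0 T) :
    Measurable (density (f t)) :=
  ((hf.continuous_slice ht).stronglyMeasurable.integral_prod_right (ν := volume)).measurable

theorem phaseNorm_one (hf : IsClassicalSolution K wB T fin f) {t : ℝ} (ht : t ∈ Icc 0 T) :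
    phaseNorm 1 (f t) = ∫⁻ z : Sp d × Sp d, ENNReal.ofReal (f t z.1 z.2) := by
  rw [phaseNorm, eLpNorm_one_eq_lintegral_enorm]
  exact lintegral_congr fun z => Real.enorm_of_nonneg (hf.nonneg t ht _ _)

/-- In phase space the time dependence sits in f alone, which is continuous in time at each point,
and the particles can be sorted by speed. -/
theorem fieldMajorant_eq (hf : IsClassicalSolution K wB T fin f) {t : ℝ} (ht : t ∈ Icc 0 T)
    (x : Sp d) : fieldMajorant K (density (f t)) x
      = ∫⁻ z : Sp d × Sp d, ENNReal.ofReal (f t z.1 z.2) * ‖gradient K (x - z.1)‖ₑ := by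
  have hm : Measurable fun z : Sp d × Sp d => ENNReal.ofReal (f t z.1 z.2) :=
    (hf.continuous_slice ht).measurable.ennreal_ofReal
  have hk : Measurable fun y : Sp d => ‖gradient K (x - y)‖ₑ :=
    ((measurable_gradient K).comp (measurable_const.sub measurable_id)).enorm
  rw [Measure.volume_eq_prod, lintegral_prod (fun z : Sp d × Sp d => ENNReal.ofReal (f t z.1 z.2)
    * ‖gradient K (x - z.1)‖ₑ) (hm.mul (hk.comp measurable_fst)).aemeasurable]
  refine lintegral_congr fun y => ?_
  rw [hf.enorm_density ht]
  exact (lintegral_mul_const _ (hm.comp (measurable_prodMk_left (x := y)))).symm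

theorem lintegral_enorm_density (hf : IsClassicalSolution K wB T fin f) {t : ℝ}
    (ht : t ∈ Icc 0 T) : ∫⁻ x, ‖density (f t) x‖ₑ = phaseNorm 1 (f t) := by
  have hm : Measurable fun z : Sp d × Sp d => ENNReal.ofReal (f t z.1 z.2) :=
    (hf.continuous_slice ht).measurable.ennreal_ofReal
  rw [hf.phaseNorm_one ht, Measure.volume_eq_prod, lintegral_prod _ hm.aemeasurable]
  exact lintegral_congr fun y => hf.enorm_density ht y

/-- The majorant of the field is lower semicontinuous in time. -/
theorem fieldMajorant_le_of_ae (hf : IsClassicalSolution K wB T fin f) (hT : 0 < T) {c : ℝ≥0∞}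
    (hc : ∀ᵐ s ∂volume.restrict (Icc 0 T), ∀ x, fieldMajorant K (density (f s)) x ≤ c)
    {t : ℝ} (ht : t ∈ Icc 0 T) (x : Sp d) : fieldMajorant K (density (f t)) x ≤ c := by
  obtain ⟨s, hs, hst⟩ := mem_closure_iff_seq_limit.1 (mem_closure_of_ae_restrict_Icc hT hc ht)
  have hk : Measurable fun y : Sp d => ‖gradient K (x - y)‖ₑ :=
    ((measurable_gradient K).comp (measurable_const.sub measurable_id)).enorm
  have hpt : ∀ z : Sp d × Sp d, Tendsto (fun k => ENNReal.ofReal (f (s k) z.1 z.2)) atTop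
      (𝓝 (ENNReal.ofReal (f t z.1 z.2))) := fun z => by
    have h1 := hf.continuousOn (t, z.1, z.2) ⟨ht, mem_univ _⟩
    refine ENNReal.tendsto_ofReal (h1.tendsto.comp (f := fun k => (s k, z.1, z.2))
      (tendsto_nhdsWithin_iff.2 ⟨?_, ?_⟩))
    · exact hst.prodMk_nhds tendsto_const_nhds
    · exact .of_forall fun k => ⟨(hs k).1, mem_univ _⟩
  rw [hf.fieldMajorant_eq ht]
  -- Fatou's lemma along times at which the bound holds. Pointwise convergence of f is enough; no
  -- continuity in time of ρ_f is needed.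
  calc _ ≤ ∫⁻ z : Sp d × Sp d, liminf (fun k => ENNReal.ofReal (f (s k) z.1 z.2)
        * ‖gradient K (x - z.1)‖ₑ) atTop := by
        refine lintegral_mono_ae ?_
        have hfin : ∀ᵐ z : Sp d × Sp d, ‖gradient K (x - z.1)‖ₑ ≠ ∞ := .of_forall fun z => by simp
        filter_upwards [hfin] with z hz
        exact (ENNReal.Tendsto.mul_const (hpt z) (Or.inr hz)).liminf_eq.ge
    _ ≤ liminf (fun k => ∫⁻ z : Sp d × Sp d, ENNReal.ofReal (f (s k) z.1 z.2)
        * ‖gradient K (x - z.1)‖ₑ) atTop := by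
        refine lintegral_liminf_le fun k => ?_
        exact (hf.continuous_slice (hs k).1).measurable.ennreal_ofReal.mul
          (hk.comp measurable_fst)
    _ ≤ c := by
        refine liminf_le_of_le (by isBoundedDefault) fun b hb => ?_
        obtain ⟨k, hk⟩ := hb.exists
        refine hk.trans ?_
        rw [← hf.fieldMajorant_eq (hs k).1]
        exact (hs k).2 x

theorem norm_gradConv_le_of_fieldMajorant {ρ : Sp d → ℝ} {x : Sp d} {e : ℝ} (he : 0 ≤ e)
    (h : fieldMajorant K ρ x ≤ ENNReal.ofReal e) : ‖gradConv K ρ x‖ ≤ e := by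
  have := (enorm_gradConv_le K ρ x).trans h
  rwa [← ofReal_norm, ENNReal.ofReal_le_ofReal_iff he] at this

/-! ### Velocity weights and the exponential estimate -/

theorem weight_mul_initial_le (hf : IsClassicalSolution K wB T fin f) (hT : 0 < T) {n : ℕ}
    (hQ : weightedSup n fin < ∞) (x v : Sp d) :
    (1 + ‖v‖ ^ n) * fin x v ≤ (weightedSup n fin).toReal := by
  have h0 : (0 : ℝ) ∈ Icc 0 T := ⟨le_rfl, hT.le⟩
  have hc : Continuous fun z : Sp d × Sp d => (1 + ‖z.2‖ ^ n) * fin z.1 z.2 := by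
    have := hf.continuous_slice h0
    rw [hf.initial] at this
    fun_prop
  exact (le_abs_self _).trans (norm_le_of_eLpNorm_top_le hc ENNReal.toReal_nonneg
    (ENNReal.ofReal_toReal hQ.ne).ge (x, v))

/-- For n ≥ 2 the power |v|^n is differentiable also at v = 0, where the maximum principle may have
to be applied. -/
theorem hasDerivAt_norm_pow_line {n : ℕ} (hn : 2 ≤ n) (v F : Sp d) :
    HasDerivAt (fun s : ℝ => 1 + ‖v - s • F‖ ^ n) (-(n * ‖v‖ ^ (n - 2) * inner ℝ v F)) 0 := by
  obtain ⟨k, rfl⟩ := Nat.exists_eq_add_of_le' hn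
  have h3 : HasDerivAt (fun s : ℝ => v - s • F) (-F) 0 := by
    simpa using ((hasDerivAt_id (0 : ℝ)).smul_const F).const_sub v
  have h4 := (hasFDerivAt_norm_rpow (v - (0 : ℝ) • F) (p := ((k + 2 : ℕ) : ℝ))
    (by push_cast; linarith [Nat.cast_nonneg (α := ℝ) k])).comp_hasDerivAt 0 h3
  have h5 := h4.const_add 1
  simp only [Real.rpow_natCast, Function.comp_def] at h5
  refine h5.congr_deriv ?_
  simp

/-- The transport derivative of the weight is -n |v|^{n-2} v·E ≤ n e |v|^{n-1} ≤ n e (1 + |v|^n), so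
the maximum principle applies with rate n e. -/
theorem mul_velocity_weight_le (hf : IsClassicalSolution K wB T fin f)
    (hw : ∀ t x v, inner ℝ v (wB t x v) = 0) (hT : 0 < T) {n : ℕ} (hn : 2 ≤ n)
    (hQ : weightedSup n fin < ∞) {e : ℝ}
    (he : ∀ t ∈ Icc 0 T, ∀ x, ‖gradConv K (density (f t)) x‖ ≤ e) {t : ℝ} (ht : t ∈ Icc 0 T)
    (x v : Sp d) :
    f t x v * (1 + ‖v‖ ^ n) ≤ (weightedSup n fin).toReal * Real.exp (n * e * t) := by
  have he0 : 0 ≤ e := (norm_nonneg _).trans (he t ht 0)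
  have key := hf.mul_weight_le hw le_rfl le_rfl (W := fun _ _ v => 1 + ‖v‖ ^ n)
    (Continuous.continuousOn (by fun_prop)) (fun _ _ _ _ => by positivity) (CW := 2) (N := n)
    (fun _ _ x v => ?_) (lam := n * e) (C₀ := (weightedSup n fin).toReal) ENNReal.toReal_nonneg
    (fun t ht x v => ⟨_, hasDerivAt_norm_pow_line hn v _, ?_⟩) (fun x v => ?_) t ht x v
  · simpa using key
  · have h1 : ‖v‖ ≤ 1 + ‖x‖ ^ 2 + ‖v‖ ^ 2 := by nlinarith [sq_nonneg ‖x‖, sq_nonneg (‖v‖ - 1)]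
    have h2 : 1 ≤ 1 + ‖x‖ ^ 2 + ‖v‖ ^ 2 := by nlinarith [sq_nonneg ‖x‖, sq_nonneg ‖v‖]
    have h3 := pow_le_pow_left₀ (norm_nonneg v) h1 n
    have h4 := one_le_pow₀ h2 (n := n)
    linarith
  · have hFE : inner ℝ v (force K wB f t x v) = inner ℝ v (gradConv K (density (f t)) x) := by
      rw [force, inner_add_right, hw, add_zero]
    rw [hFE]
    obtain ⟨k, rfl⟩ := Nat.exists_eq_add_of_le' hn
    have h1 : -inner ℝ v (gradConv K (density (f t)) x) ≤ ‖v‖ * e :=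
      (neg_le_abs _).trans ((abs_real_inner_le_norm _ _).trans
        (by gcongr; exact he t ⟨ht.1.le, ht.2.le⟩ x))
    have h2 : ‖v‖ ^ (k + 1) ≤ 1 + ‖v‖ ^ (k + 2) := by
      rcases le_total ‖v‖ 1 with h | h
      · have := pow_le_one₀ (norm_nonneg v) h (n := k + 1)
        have : 0 ≤ ‖v‖ ^ (k + 2) := by positivity
        linarith
      · have := pow_le_pow_right₀ h (show k + 1 ≤ k + 2 by omega)
        linarith
    simp only [Nat.add_sub_cancel]
    calc _ = ((k + 2 : ℕ) : ℝ) * ‖v‖ ^ k * -inner ℝ v (gradConv K (density (f t)) x) := by ring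
      _ ≤ ((k + 2 : ℕ) : ℝ) * ‖v‖ ^ k * (‖v‖ * e) := by gcongr
      _ = ((k + 2 : ℕ) : ℝ) * e * ‖v‖ ^ (k + 1) := by ring
      _ ≤ _ := by gcongr
  · rw [hf.initial, mul_comm]
    exact hf.weight_mul_initial_le hT hQ x v

theorem density_le (hf : IsClassicalSolution K wB T fin f)
    (hw : ∀ t x v, inner ℝ v (wB t x v) = 0) (hT : 0 < T) {n : ℕ} (hn : 2 ≤ n) (hdn : d < n)
    (hQ : weightedSup n fin < ∞) {e : ℝ}
    (he : ∀ t ∈ Icc 0 T, ∀ x, ‖gradConv K (density (f t)) x‖ ≤ e) {t : ℝ} (ht : t ∈ Icc 0 T)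
    (x : Sp d) :
    density (f t) x ≤ velConst d n * Real.exp (n * e * t) * (weightedSup n fin).toReal := by
  have hI := (integrable_one_div_one_add_norm_pow hdn).const_mul
    ((weightedSup n fin).toReal * Real.exp (n * e * t))
  calc density (f t) x
      ≤ ∫ v : Sp d, (weightedSup n fin).toReal * Real.exp (n * e * t) * (1 / (1 + ‖v‖ ^ n)) := by
        refine integral_mono (hf.density_exists t ht x) hI fun v => ?_
        simp only
        rw [mul_one_div, le_div_iff₀ (by positivity)]
        exact hf.mul_velocity_weight_le hw hT hn hQ he ht x v
    _ = _ := by rw [integral_const_mul, velConst]; ring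

theorem eLpNorm_density_top_le (hf : IsClassicalSolution K wB T fin f) {t : ℝ}
    (ht : t ∈ Icc 0 T) {M : ℝ} (hM : ∀ x, density (f t) x ≤ M) :
    eLpNorm (density (f t)) ∞ volume ≤ ENNReal.ofReal M := by
  rw [eLpNorm_exponent_top]
  refine eLpNormEssSup_le_of_ae_bound (.of_forall fun x => ?_)
  rw [Real.norm_of_nonneg (hf.density_nonneg ht x)]
  exact hM x

end IsClassicalSolution

theorem velConst_pos {d n : ℕ} (hdn : d < n) : 0 < velConst d n := by
  refine integral_pos_of_integrable_nonneg_nonzero (x := 0) ?_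
    (integrable_one_div_one_add_norm_pow hdn) (fun v => by positivity) (by positivity)
  exact Continuous.div (by fun_prop) (by fun_prop) fun v => by positivity

/-- The exponential estimate for the density, given any bound `a r` of the field for almost
every time. -/
theorem IsClassicalSolution.eLpNorm_density_le_expBound {d : ℕ} {K : Sp d → ℝ}
    {wB : ℝ → Sp d → Sp d → Sp d} {T : ℝ} {fin : Sp d → Sp d → ℝ} {f : ℝ → Sp d → Sp d → ℝ}
    (hf : IsClassicalSolution K wB T fin f)
    (hw : ∀ t x v, inner ℝ v (wB t x v) = 0) (hT : 0 < T) {n : ℕ} (hn : 2 ≤ n) (hdn : d < n)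
    (hQ : weightedSup n fin < ∞) {e : ℝ}
    (he : ∀ t ∈ Icc 0 T, ∀ x, ‖gradConv K (density (f t)) x‖ ≤ e) {a r : ℝ≥0∞}
    (har : ∀ᵐ s ∂volume.restrict (Icc 0 T), ∀ x, fieldMajorant K (density (f s)) x ≤ a * r)
    {t : ℝ} (ht : t ∈ Icc 0 T) :
    eLpNorm (density (f t)) ∞ volume ≤ expBound n a r t fin := by
  have hform : ∀ {e' : ℝ}, 0 ≤ e' →
      (∀ x, density (f t) x ≤ velConst d n * Real.exp e' * (weightedSup n fin).toReal) →
      (e' : EReal) = (((n : ℝ≥0∞) * a * r * ENNReal.ofReal t : ℝ≥0∞) : EReal) →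
      eLpNorm (density (f t)) ∞ volume ≤ expBound n a r t fin := by
    intro e' he' hb heq
    refine (hf.eLpNorm_density_top_le ht hb).trans (le_of_eq ?_)
    rw [expBound, ← heq, EReal.exp_coe, ENNReal.ofReal_mul (by have := velConst_pos hdn; positivity),
      ENNReal.ofReal_mul (velConst_pos hdn).le, ENNReal.ofReal_toReal hQ.ne]
  -- If a r is infinite, as may happen for the strong norm of ∇K, the right-hand side is ∞ except at
  -- t = 0 or for vanishing weighted norm. In these two cases 0·∞ = 0 leaves a genuine estimate,
  -- which follows from the qualitative bound e. If a r is finite, it takes the place of e.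
  rcases eq_or_ne (a * r) ∞ with htop | hfin
  · rcases eq_or_lt_of_le ht.1 with h0 | h0
    · refine hform le_rfl (fun x => ?_) (by simp [← h0])
      have := hf.density_le hw hT hn hdn hQ he ht x
      simpa [← h0] using this
    rcases eq_or_ne (weightedSup n fin) 0 with hz | hz
    · refine (hf.eLpNorm_density_top_le ht (M := 0) fun x => ?_).trans (by simp)
      have := hf.density_le hw hT hn hdn hQ he ht x
      simpa [hz] using this
    · have h1 : (n : ℝ≥0∞) * a * r * ENNReal.ofReal t = ∞ := by
        rw [mul_assoc (n : ℝ≥0∞), htop, ENNReal.mul_top (by simp; omega),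
          ENNReal.top_mul (by simpa using h0)]
      rw [expBound, h1, EReal.coe_ennreal_top, EReal.exp_top,
        ENNReal.mul_top (by simpa using velConst_pos hdn), ENNReal.top_mul hz]
      exact le_top
  · have he1 : ∀ t ∈ Icc 0 T, ∀ x, ‖gradConv K (density (f t)) x‖ ≤ (a * r).toReal :=
      fun t ht x => IsClassicalSolution.norm_gradConv_le_of_fieldMajorant ENNReal.toReal_nonneg
        ((hf.fieldMajorant_le_of_ae hT har ht x).trans (ENNReal.ofReal_toReal hfin).ge)
    have ht0 : 0 ≤ t := ht.1
    refine hform (e' := n * (a * r).toReal * t) (by positivity)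
      (fun x => hf.density_le hw hT hn hdn hQ he1 ht x) ?_
    rw [mul_assoc (n : ℝ≥0∞)]
    have h2 : (n : ℝ≥0∞) * (a * r) * ENNReal.ofReal t
        = ENNReal.ofReal (n * (a * r).toReal * t) := by
      rw [ENNReal.ofReal_mul (by positivity), ENNReal.ofReal_mul (by positivity),
        ENNReal.ofReal_toReal hfin, ENNReal.ofReal_natCast]
    rw [h2, EReal.coe_ennreal_ofReal, max_eq_left (by positivity)]

/-! ### Interpolation between `L^1` and `L^∞` -/

/-- Levels above M contribute nothing, and below M Chebyshev's inequality gives |{|ρ| > s}| ≤ A/s.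
For p > 1 the remaining integral converges at zero. -/
theorem lorentzOneNorm_le {d : ℕ} {p A M : ℝ} (hp : 0 < p) {ρ : Sp d → ℝ}
    (hρ : Measurable ρ) (hA : ∫⁻ x, ‖ρ x‖ₑ ≤ ENNReal.ofReal A) (hM : ∀ x, ‖ρ x‖ ≤ M) :
    lorentzOneNorm p ρ ≤ ENNReal.ofReal p
      * ∫⁻ s in Ioc 0 M, (ENNReal.ofReal A / ENNReal.ofReal s) ^ (1 / p) := by
  have hp' : 0 < 1 / p := by positivity
  have hM0 : 0 ≤ M := (norm_nonneg _).trans (hM 0)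
  rw [lorentzOneNorm]
  refine mul_le_mul_right ?_ _
  rw [← Ioc_union_Ioi_eq_Ioi hM0, lintegral_union measurableSet_Ioi Ioc_disjoint_Ioi_same]
  have hz : ∫⁻ s in Ioi M, volume {x : Sp d | ENNReal.ofReal s < ‖ρ x‖ₑ} ^ (1 / p) = 0 := by
    refine setLIntegral_eq_zero measurableSet_Ioi fun s hs => ?_
    have : {x : Sp d | ENNReal.ofReal s < ‖ρ x‖ₑ} = ∅ := by
      refine Set.eq_empty_iff_forall_notMem.2 fun x hx => ?_
      rw [mem_ofPred_eq, ← ofReal_norm] at hx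
      exact absurd hx (not_lt.2 (ENNReal.ofReal_le_ofReal ((hM x).trans (le_of_lt hs))))
    simp [this, hp]
  rw [hz, add_zero]
  refine setLIntegral_mono' measurableSet_Ioc fun s hs => ?_
  gcongr
  rw [ENNReal.le_div_iff_mul_le (Or.inl (by simpa using hs.1)) (Or.inl ENNReal.ofReal_ne_top),
    mul_comm]
  refine le_trans ?_ ((mul_meas_ge_le_lintegral₀ hρ.enorm.aemeasurable (ENNReal.ofReal s)).trans hA)
  gcongr with x
  exact fun h => h.le

theorem lintegral_Ioc_div_rpow_lt_top {A M q : ℝ} (hq : 0 < q) (hq1 : q < 1) :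
    ∫⁻ s in Ioc 0 M, (ENNReal.ofReal A / ENNReal.ofReal s) ^ q < ∞ := by
  rcases le_total M 0 with hM | hM
  · simp [Ioc_eq_empty_of_le hM]
  have h1 : IntegrableOn (fun s : ℝ => (max A 0) ^ q * s ^ (-q)) (Ioc 0 M) :=
    ((intervalIntegral.intervalIntegrable_rpow' (a := 0) (b := M) (by linarith)).1).const_mul _
  refine lt_of_le_of_lt (setLIntegral_mono' measurableSet_Ioc fun s hs => ?_) h1.lintegral_lt_top
  have hA : ENNReal.ofReal A = ENNReal.ofReal (max A 0) := by
    rcases le_total A 0 with h | h <;> simp [h]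
  rw [hA, ← ENNReal.ofReal_div_of_pos hs.1,
    ENNReal.ofReal_rpow_of_nonneg (div_nonneg (le_max_right _ _) hs.1.le) hq.le,
    Real.div_rpow (le_max_right _ _) hs.1.le, Real.rpow_neg hs.1.le, div_eq_mul_inv]

/-- For finite p, integrate |g|^p ≤ φ^{p-1} |g|. One constant thus serves all exponents. -/
theorem eLpNorm_le_of_norm_le_of_lintegral_le {X : Type*} [MeasurableSpace X] {μ : Measure X}
    {g : X → ℝ} {φ : ℝ} (h1 : ∫⁻ x, ‖g x‖ₑ ∂μ ≤ ENNReal.ofReal φ)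
    (h2 : ∀ x, ‖g x‖ ≤ φ) {p : ℝ≥0∞} (hp : 1 ≤ p) : eLpNorm g p μ ≤ ENNReal.ofReal φ := by
  rcases eq_or_ne p ∞ with rfl | hpt
  · rw [eLpNorm_exponent_top]
    exact eLpNormEssSup_le_of_ae_bound (.of_forall h2)
  have hp0 : p ≠ 0 := (zero_lt_one.trans_le hp).ne'
  have hpr : 1 ≤ p.toReal := by
    rwa [← ENNReal.toReal_one, ENNReal.toReal_le_toReal ENNReal.one_ne_top hpt]
  have hpp : 0 < p.toReal := by linarith
  rw [eLpNorm_eq_lintegral_rpow_enorm_toReal hp0 hpt, one_div, ENNReal.rpow_inv_le_iff hpp]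
  calc ∫⁻ x, ‖g x‖ₑ ^ p.toReal ∂μ
      ≤ ∫⁻ x, ENNReal.ofReal φ ^ (p.toReal - 1) * ‖g x‖ₑ ∂μ := by
        refine lintegral_mono fun x => ?_
        have hx : ‖g x‖ₑ ≤ ENNReal.ofReal φ := by
          rw [← ofReal_norm]; exact ENNReal.ofReal_le_ofReal (h2 x)
        calc ‖g x‖ₑ ^ p.toReal = ‖g x‖ₑ ^ (p.toReal - 1) * ‖g x‖ₑ := by
              conv_lhs => rw [← sub_add_cancel p.toReal 1]
              rw [ENNReal.rpow_add_of_nonneg _ _ (by linarith) zero_le_one, ENNReal.rpow_one]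
          _ ≤ _ := by gcongr
    _ = ENNReal.ofReal φ ^ (p.toReal - 1) * ∫⁻ x, ‖g x‖ₑ ∂μ := by
        rw [lintegral_const_mul']
        exact ENNReal.rpow_ne_top_of_nonneg (by linarith) ENNReal.ofReal_ne_top
    _ ≤ ENNReal.ofReal φ ^ (p.toReal - 1) * ENNReal.ofReal φ := by gcongr
    _ = ENNReal.ofReal φ ^ p.toReal := by
        conv_rhs => rw [← sub_add_cancel p.toReal 1]
        rw [ENNReal.rpow_add_of_nonneg _ _ (by linarith) zero_le_one, ENNReal.rpow_one]

/-- All the bounds on the density follow from the boundedness of the field. -/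
theorem IsClassicalSolution.densityBounds_of_bounded_field {d : ℕ} (hd : d = 2 ∨ d = 3)
    {K : Sp d → ℝ} (hK : ∀ x ≠ 0, ‖gradient K x‖ ≤ 1 / ‖x‖ ^ (d - 1))
    {wB : ℝ → Sp d → Sp d → Sp d} {T : ℝ} {fin : Sp d → Sp d → ℝ} {f : ℝ → Sp d → Sp d → ℝ}
    (hf : IsClassicalSolution K wB T fin f)
    (hw : ∀ t x v, inner ℝ v (wB t x v) = 0) (hT : 0 < T) {n : ℕ} (hdn : d < n)
    (hQ : weightedSup n fin < ∞) {e : ℝ}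
    (he : ∀ t ∈ Icc 0 T, ∀ x, ‖gradConv K (density (f t)) x‖ ≤ e) :
    DensityBounds K n T fin f := by
  have hn : 2 ≤ n := by rcases hd with rfl | rfl <;> omega
  have hb := one_lt_bExp d
  have hb' : 1 < bConj d := by
    rw [bConj, one_lt_div (by linarith)]; linarith
  have hweak := weakLpNorm_gradient_lt_top hd hK
  obtain ⟨A, hA, -, hmass⟩ := hf.exists_bound
  set M : ℝ := velConst d n * Real.exp (n * e * T) * (weightedSup n fin).toReal with hM
  have he0 : 0 ≤ e := (norm_nonneg _).trans (he 0 ⟨le_rfl, hT.le⟩ 0)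
  have hρM : ∀ t ∈ Icc 0 T, ∀ x, density (f t) x ≤ M := fun t ht x => by
    refine (hf.density_le hw hT hn hdn hQ he ht x).trans ?_
    have := velConst_pos hdn
    have := ht.2
    rw [hM]
    gcongr
  have hρM' : ∀ t ∈ Icc 0 T, ∀ x, ‖density (f t) x‖ ≤ M := fun t ht x => by
    rw [Real.norm_of_nonneg (hf.density_nonneg ht x)]
    exact hρM t ht x
  have hρA : ∀ t ∈ Icc 0 T, ∫⁻ x, ‖density (f t) x‖ₑ ≤ ENNReal.ofReal A := fun t ht => by
    rw [hf.lintegral_enorm_density ht]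
    exact hmass t ht
  have hIcc : ∀ {P : ℝ → Prop}, (∀ t ∈ Icc 0 T, P t) →
      ∀ᵐ s ∂volume.restrict (Icc 0 T), P s := fun h =>
    (ae_restrict_iff' measurableSet_Icc).2 (.of_forall h)
  have hess : ∀ φ : ℝ → ℝ≥0∞, ∀ᵐ s ∂volume.restrict (Icc 0 T), φ s ≤ timeSup T φ :=
    fun φ => ae_le_essSup
  refine ⟨hweak, ?_, fun t ht => ?_, fun t ht => ?_, ?_, ?_⟩
  · refine lt_of_le_of_lt (essSup_le_of_ae_le _ (hIcc fun t ht =>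
      lorentzOneNorm_le (by linarith) (hf.measurable_density ht) (hρA t ht) (hρM' t ht))) ?_
    refine ENNReal.mul_lt_top ENNReal.ofReal_lt_top (lintegral_Ioc_div_rpow_lt_top ?_ ?_)
    · positivity
    · rw [div_lt_one (by linarith)]; exact hb'
  · refine hf.eLpNorm_density_le_expBound hw hT hn hdn hQ he ?_ ht
    filter_upwards [hess fun s => lorentzOneNorm (bConj d) (density (f s)),
      hIcc fun t ht => hf.measurable_density ht] with s hs hm x
    refine (fieldMajorant_le_weak hb hweak.ne hm x).trans ?_
    gcongr
    exact hs
  · refine hf.eLpNorm_density_le_expBound hw hT hn hdn hQ he ?_ ht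
    filter_upwards [hess fun s => eLpNorm (density (f s)) (ENNReal.ofReal (bConj d)) volume,
      hIcc fun t ht => hf.measurable_density ht] with s hs hm x
    refine (fieldMajorant_le_eLpNorm hb hm x).trans ?_
    gcongr
    exact hs
  · exact lt_of_le_of_lt (essSup_le_of_ae_le _ (hIcc fun t ht =>
      hf.eLpNorm_density_top_le ht (hρM t ht))) ENNReal.ofReal_lt_top
  · refine ⟨max 1 (max A M), by positivity, fun p hp t ht => ?_⟩
    refine eLpNorm_le_of_norm_le_of_lintegral_le ?_ (fun x => ?_) hp
    · exact (hρA t ht).trans (ENNReal.ofReal_le_ofReal (by simp))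
    · exact (hρM' t ht x).trans (by simp)

/-! ### Propagation of moments -/

/-- The divergence theorem for a compactly supported function and an affine vector field with
skew-symmetric linear part. -/
theorem integral_fderiv_affine_skew_eq_zero {d : ℕ} {u : Sp d → ℝ} (hu : ContDiff ℝ 1 u)
    (hc : HasCompactSupport u) (a : Sp d) (M : Sp d →L[ℝ] Sp d) (hM : ∀ w, inner ℝ (M w) w = 0) :
    ∫ w, fderiv ℝ u w (a + M w) = 0 := by
  set b := EuclideanSpace.basisFun (Fin d) ℝ
  have hud : Differentiable ℝ u := hu.differentiable (by norm_num)
  have hcf : Continuous (fderiv ℝ u) := hu.continuous_fderiv (by norm_num)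
  have hc' : HasCompactSupport (fderiv ℝ u) := hc.fderiv ℝ
  set L : Fin d → Sp d → ℝ := fun i w => inner ℝ (b i) (a + M w)
  have hLd : ∀ i w, HasFDerivAt (L i) ((innerSL ℝ (b i)).comp M) w := fun i w =>
    (innerSL ℝ (b i)).hasFDerivAt.comp w (M.hasFDerivAt.const_add a)
  have hLdiff : ∀ i, Differentiable ℝ (L i) := fun i w => (hLd i w).differentiableAt
  have hcs : ∀ i, HasCompactSupport fun w => fderiv ℝ u w (b i) := fun i =>
    hc'.comp_left (g := fun T : Sp d →L[ℝ] ℝ => T (b i)) (by simp)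
  have hsum : ∀ w, fderiv ℝ u w (a + M w) = ∑ i, L i w * fderiv ℝ u w (b i) := fun w => by
    conv_lhs => rw [← b.sum_repr' (a + M w)]
    simp [L]
  have hint : ∀ i, Integrable fun w => L i w * fderiv ℝ u w (b i) := fun i =>
    ((hLdiff i).continuous.mul (by fun_prop)).integrable_of_hasCompactSupport (hcs i).mul_left
  simp_rw [hsum]
  rw [integral_finsetSum _ fun i _ => hint i]
  refine Finset.sum_eq_zero fun i _ => ?_
  -- The diagonal entries of a skew matrix vanish, so integrating by parts in the i-th coordinate
  -- leaves no term.
  have hz : ∀ w, fderiv ℝ (L i) w (b i) = 0 := fun w => by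
    rw [(hLd i w).fderiv]
    simpa [real_inner_comm] using hM (b i)
  rw [integral_mul_fderiv_eq_neg_fderiv_mul_of_integrable (by simp [hz]) (hint i)
    (((hLdiff i).continuous.mul hu.continuous).integrable_of_hasCompactSupport hc.mul_left)
    (fun w _ => hLdiff i w) (fun w _ => hud w)]
  simp [hz]

theorem integrable_of_continuous_of_eq_zero {X : Type*} [NormedAddCommGroup X] [ProperSpace X]
    [MeasurableSpace X] [OpensMeasurableSpace X] {μ : Measure X} [IsFiniteMeasureOnCompacts μ]
    {g : X → ℝ} (hg : Continuous g) {R : ℝ} (h0 : ∀ x, R < ‖x‖ → g x = 0) : Integrable g μ :=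
  hg.integrable_of_hasCompactSupport
    (HasCompactSupport.intro (isCompact_closedBall (0 : X) R) fun x hx => h0 x (by simpa using hx))

/-- The integral of a classical solution against a compactly supported weight whose transport
derivative is nonpositive does not increase. -/
theorem IsClassicalSolution.integral_mul_le {d : ℕ} {K : Sp d → ℝ}
    {wB : ℝ → Sp d → Sp d → Sp d} {T : ℝ} {fin : Sp d → Sp d → ℝ} {f : ℝ → Sp d → Sp d → ℝ}
    (hf : IsClassicalSolution K wB T fin f)
    (hskew : ∀ t x, ∃ M : Sp d →L[ℝ] Sp d, (∀ v, wB t x v = M v) ∧ ∀ v, inner ℝ (M v) v = 0)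
    {Φ : ℝ × Sp d × Sp d → ℝ} (hΦ : ContDiff ℝ 1 Φ) {R : ℝ}
    (hsupp : ∀ t ∈ Icc 0 T, ∀ z : Sp d × Sp d, R < ‖z‖ → Φ (t, z) = 0)
    (hD : ∀ t ∈ Ioo 0 T, ∀ x v, fderiv ℝ Φ (t, x, v) (1, v, -force K wB f t x v) ≤ 0)
    {t : ℝ} (ht : t ∈ Icc 0 T) :
    ∫ z : Sp d × Sp d, f t z.1 z.2 * Φ (t, z) ≤ ∫ z : Sp d × Sp d, fin z.1 z.2 * Φ (0, z) := by
  set U : ℝ × Sp d × Sp d → ℝ := fun z => f z.1 z.2.1 z.2.2 * Φ z with hU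
  set O : Set (ℝ × Sp d × Sp d) := Ioo 0 T ×ˢ univ
  have hO : IsOpen O := isOpen_Ioo.prod isOpen_univ
  have hIoo : Ioo 0 T ⊆ Icc 0 T := Ioo_subset_Icc_self
  have hUc : ContDiffOn ℝ 1 U O := hf.contDiffOn.mul hΦ.contDiffOn
  have hUcont : ContinuousOn U (Icc 0 T ×ˢ univ) := hf.continuousOn.mul hΦ.continuous.continuousOn
  have hDc : ContinuousOn (fderiv ℝ U) O := hUc.continuousOn_fderiv_of_isOpen hO (by norm_num)
  have hUd : ∀ t ∈ Ioo 0 T, ∀ z : Sp d × Sp d, DifferentiableAt ℝ U (t, z) := fun t ht z =>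
    (hUc.differentiableOn (by norm_num)).differentiableAt (hO.mem_nhds ⟨ht, mem_univ _⟩)
  have hU0 : ∀ t ∈ Icc 0 T, ∀ z : Sp d × Sp d, R < ‖z‖ → U (t, z) = 0 := fun t ht z hz => by
    simp [hU, hsupp t ht z hz]
  have hD0 : ∀ t ∈ Ioo 0 T, ∀ z : Sp d × Sp d, R < ‖z‖ → fderiv ℝ U (t, z) = 0 := by
    intro t ht z hz
    have hev : U =ᶠ[𝓝 (t, z)] fun _ => (0 : ℝ) := by
      have ho : IsOpen {p : ℝ × Sp d × Sp d | p.1 ∈ Ioo 0 T ∧ R < ‖p.2‖} :=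
        (isOpen_Ioo.preimage continuous_fst).inter
          (isOpen_lt continuous_const (continuous_snd.norm))
      filter_upwards [ho.mem_nhds ⟨ht, hz⟩] with p hp
      exact hU0 p.1 (hIoo hp.1) p.2 hp.2
    rw [hev.fderiv_eq]; simp
  have hsliceD : ∀ t ∈ Ioo 0 T, Continuous fun z : Sp d × Sp d => fderiv ℝ U (t, z) :=
    fun t ht => hDc.comp_continuous (by fun_prop) fun z => ⟨ht, mem_univ _⟩
  have hslice : ∀ t ∈ Icc 0 T, Continuous fun z : Sp d × Sp d => U (t, z) :=
    fun t ht => hUcont.comp_continuous (by fun_prop) fun z => ⟨ht, mem_univ _⟩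
  -- the derivative of the integral has the right sign
  have hsign : ∀ t ∈ Ioo 0 T, ∫ z : Sp d × Sp d, fderiv ℝ U (t, z) (1, 0, 0) ≤ 0 := by
    intro t ht
    have hDct := hsliceD t ht
    -- The time derivative is split as D U(1, v, 0) - D U(0, v, 0), both parts being continuous on
    -- phase space. The force is kept out of the joint integrand, since `wB` need not be measurable
    -- in x; it is inserted below for each fixed x, where it is affine in v and integrates to zero.
    have hP : Integrable fun z : Sp d × Sp d => fderiv ℝ U (t, z) (0, z.2, 0) :=
      integrable_of_continuous_of_eq_zero (by fun_prop) (R := R) fun z hz => by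
        simp [hD0 t ht z hz]
    have hN : Integrable fun z : Sp d × Sp d => fderiv ℝ U (t, z) (1, z.2, 0) :=
      integrable_of_continuous_of_eq_zero (by fun_prop) (R := R) fun z hz => by
        simp [hD0 t ht z hz]
    have hP0 : ∫ z : Sp d × Sp d, fderiv ℝ U (t, z) (0, z.2, 0) = 0 := by
      rw [Measure.volume_eq_prod, integral_prod_symm _ hP]
      refine integral_eq_zero_of_ae (.of_forall fun v => ?_)
      rw [Pi.zero_apply]
      have hcd : ContDiff ℝ 1 fun x : Sp d => U (t, x, v) :=
        hUc.comp_contDiff (by fun_prop) fun x => ⟨ht, mem_univ _⟩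
      have hcs : HasCompactSupport fun x : Sp d => U (t, x, v) :=
        HasCompactSupport.intro (isCompact_closedBall (0 : Sp d) R) fun x hx =>
          hU0 t (hIoo ht) _ (lt_of_lt_of_le (by simpa using hx) (norm_fst_le (x, v)))
      have h := integral_fderiv_affine_skew_eq_zero hcd hcs v 0 (by simp)
      refine Eq.trans (integral_congr_ae (.of_forall fun x => ?_)) h
      have hh : HasFDerivAt (fun y : Sp d => (t, y, v))
          ((0 : Sp d →L[ℝ] ℝ).prod ((ContinuousLinearMap.id ℝ (Sp d)).prod 0)) x :=
        (hasFDerivAt_const t x).prodMk ((hasFDerivAt_id x).prodMk (hasFDerivAt_const v x))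
      have := ((hUd t ht (x, v)).hasFDerivAt.comp x hh).fderiv
      change _ = fderiv ℝ (U ∘ fun y => (t, y, v)) x _
      rw [this]; simp
    have hN0 : ∫ z : Sp d × Sp d, fderiv ℝ U (t, z) (1, z.2, 0) ≤ 0 := by
      rw [Measure.volume_eq_prod, integral_prod _ hN]
      refine integral_nonpos fun x => ?_
      obtain ⟨M, hM, hM0⟩ := hskew t x
      have hcd : ContDiff ℝ 1 fun v : Sp d => U (t, x, v) :=
        hUc.comp_contDiff (by fun_prop) fun x => ⟨ht, mem_univ _⟩
      have hcs : HasCompactSupport fun v : Sp d => U (t, x, v) :=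
        HasCompactSupport.intro (isCompact_closedBall (0 : Sp d) R) fun v hv =>
          hU0 t (hIoo ht) _ (lt_of_lt_of_le (by simpa using hv) (norm_snd_le (x, v)))
      have h := integral_fderiv_affine_skew_eq_zero hcd hcs (gradConv K (density (f t)) x) M hM0
      have hfd : ∀ v, fderiv ℝ (fun v : Sp d => U (t, x, v)) v
          (gradConv K (density (f t)) x + M v) = fderiv ℝ U (t, x, v) (0, 0, force K wB f t x v) := by
        intro v
        have hh : HasFDerivAt (fun w : Sp d => (t, x, w))
            ((0 : Sp d →L[ℝ] ℝ).prod ((0 : Sp d →L[ℝ] Sp d).prod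
              (ContinuousLinearMap.id ℝ (Sp d)))) v :=
          (hasFDerivAt_const t v).prodMk ((hasFDerivAt_const x v).prodMk (hasFDerivAt_id v))
        have := ((hUd t ht (x, v)).hasFDerivAt.comp v hh).fderiv
        change fderiv ℝ (U ∘ fun w => (t, x, w)) v _ = _
        rw [this, force, hM]; simp
      have hIr : Integrable fun v : Sp d => fderiv ℝ (fun v : Sp d => U (t, x, v)) v
          (gradConv K (density (f t)) x + M v) := by
        have h1 : Continuous (fderiv ℝ fun v : Sp d => U (t, x, v)) :=
          hcd.continuous_fderiv (by norm_num)
        refine integrable_of_continuous_of_eq_zero (by fun_prop) (R := R) fun v hv => ?_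
        rw [hfd, hD0 t ht (x, v) (hv.trans_le (norm_snd_le (x, v)))]; simp
      have hIl : Integrable fun v : Sp d => fderiv ℝ U (t, x, v) (1, v, 0) := by
        have h1 : Continuous fun v : Sp d => fderiv ℝ U (t, x, v) :=
          hDct.comp (by fun_prop : Continuous fun v : Sp d => (x, v))
        refine integrable_of_continuous_of_eq_zero (by fun_prop) (R := R) fun v hv => ?_
        rw [hD0 t ht (x, v) (hv.trans_le (norm_snd_le (x, v)))]; simp
      calc ∫ v, fderiv ℝ U (t, x, v) (1, v, 0)
          ≤ ∫ v, fderiv ℝ (fun v : Sp d => U (t, x, v)) v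
            (gradConv K (density (f t)) x + M v) := by
            refine integral_mono hIl hIr fun v => ?_
            simp only
            rw [hfd]
            have hUf := ((hf.differentiableAt ht x v).hasFDerivAt.mul
              (hΦ.differentiable (by norm_num) (t, x, v)).hasFDerivAt).fderiv
            have h2 : fderiv ℝ U (t, x, v) (1, v, -force K wB f t x v) ≤ 0 := by
              change fderiv ℝ ((fun z : ℝ × Sp d × Sp d => f z.1 z.2.1 z.2.2) * Φ) (t, x, v) _ ≤ 0
              rw [hUf]
              simp only [add_apply, smul_apply,
                hf.fderiv_transport ht x v, smul_eq_mul, mul_zero, add_zero]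
              exact mul_nonpos_of_nonneg_of_nonpos (hf.nonneg t (hIoo ht) x v) (hD t ht x v)
            have h3 : ((1 : ℝ), v, (0 : Sp d))
                = (1, v, -force K wB f t x v) + (0, 0, force K wB f t x v) := by simp
            rw [h3, map_add]
            linarith
        _ = 0 := h
    have h4 : ∀ z : Sp d × Sp d, fderiv ℝ U (t, z) (1, 0, 0)
        = fderiv ℝ U (t, z) (1, z.2, 0) - fderiv ℝ U (t, z) (0, z.2, 0) := fun z => by
      rw [← map_sub]; congr 1; simp [Prod.ext_iff]
    simp_rw [h4]
    rw [integral_sub hN hP, hP0, sub_zero]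
    exact hN0
  -- differentiation and continuity of the integral
  have hbd : ∀ (G : ℝ × Sp d × Sp d → ℝ) (α β : ℝ), ContinuousOn G (Icc α β ×ˢ univ) →
      (∀ t ∈ Icc α β, ∀ z : Sp d × Sp d, R < ‖z‖ → G (t, z) = 0) →
      ∃ bound : Sp d × Sp d → ℝ, Integrable bound ∧
        ∀ t ∈ Icc α β, ∀ z, ‖G (t, z)‖ ≤ bound z := by
    intro G α β hG hG0
    obtain ⟨C, hC⟩ := (isCompact_Icc.prod (isCompact_closedBall (0 : Sp d × Sp d) R)).exists_bound_of_continuousOn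
      (hG.mono (prod_mono_right (subset_univ _)))
    refine ⟨(Metric.closedBall 0 R).indicator fun _ => max C 0, ?_, fun t ht z => ?_⟩
    · exact (integrable_indicator_iff Metric.isClosed_closedBall.measurableSet).2
        (integrableOn_const (isCompact_closedBall _ _).measure_lt_top.ne)
    · by_cases hz : z ∈ Metric.closedBall (0 : Sp d × Sp d) R
      · rw [indicator_of_mem hz]
        exact (hC (t, z) ⟨ht, hz⟩).trans (le_max_left _ _)
      · rw [indicator_of_notMem hz, hG0 t ht z (by simpa using hz), norm_zero]
  have hcont : ContinuousOn (fun t => ∫ z : Sp d × Sp d, U (t, z)) (Icc 0 T) := by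
    obtain ⟨bound, hb1, hb2⟩ := hbd U 0 T hUcont hU0
    refine continuousOn_of_dominated (fun t ht => (hslice t ht).aestronglyMeasurable)
      (fun t ht => .of_forall (hb2 t ht)) hb1 (.of_forall fun z => ?_)
    exact hUcont.comp (Continuous.continuousOn (by fun_prop)) fun t ht => ⟨ht, mem_univ _⟩
  have hder : ∀ t ∈ Ioo 0 T, HasDerivAt (fun t => ∫ z : Sp d × Sp d, U (t, z))
      (∫ z : Sp d × Sp d, fderiv ℝ U (t, z) (1, 0, 0)) t := by
    intro t ht
    -- The derivative of U may blow up at the end times, so it is dominated on a compact interval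
    -- around t.
    have hsub : Icc (t / 2) ((t + T) / 2) ⊆ Ioo 0 T := fun s hs =>
      ⟨by linarith [hs.1, ht.1], by linarith [hs.2, ht.2]⟩
    obtain ⟨bound, hb1, hb2⟩ := hbd (fun p => fderiv ℝ U p (1, 0, 0)) (t / 2) ((t + T) / 2)
      ((hDc.mono (prod_mono hsub subset_rfl)).clm_apply continuousOn_const)
      (fun s hs z hz => by simp [hD0 s (hsub hs) z hz])
    have hnhds : Icc (t / 2) ((t + T) / 2) ∈ 𝓝 t :=
      Icc_mem_nhds (by linarith [ht.1]) (by linarith [ht.2])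
    refine (hasDerivAt_integral_of_dominated_loc_of_deriv_le (μ := volume)
      (F := fun s (z : Sp d × Sp d) => U (s, z))
      (F' := fun s (z : Sp d × Sp d) => fderiv ℝ U (s, z) (1, 0, 0)) hnhds ?_ ?_ ?_
      (.of_forall fun z s hs => hb2 s hs z) hb1 (.of_forall fun z s hs => ?_)).2
    · filter_upwards [hnhds] with s hs
      exact (hslice s (hIoo (hsub hs))).aestronglyMeasurable
    · exact integrable_of_continuous_of_eq_zero (hslice t (hIoo ht)) (R := R) (hU0 t (hIoo ht))
    · have := hsliceD t ht
      exact Continuous.aestronglyMeasurable (by fun_prop)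
    · have h1 : HasDerivAt (fun s : ℝ => (s, z)) ((1 : ℝ), (0 : Sp d × Sp d)) s :=
        (hasDerivAt_id s).prodMk (hasDerivAt_const s z)
      exact (hUd s (hsub hs) z).hasFDerivAt.comp_hasDerivAt s h1
  have hanti : AntitoneOn (fun t => ∫ z : Sp d × Sp d, U (t, z)) (Icc 0 T) := by
    refine antitoneOn_of_hasDerivWithinAt_nonpos (convex_Icc 0 T) hcont
      (f' := fun t => ∫ z : Sp d × Sp d, fderiv ℝ U (t, z) (1, 0, 0)) ?_ ?_
    · rw [interior_Icc]
      exact fun t ht => (hder t ht).hasDerivWithinAt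
    · rw [interior_Icc]
      exact hsign
  have := hanti ⟨le_rfl, ht.1.trans ht.2⟩ ht ht.1
  simpa [hU, hf.initial] using this

/-- The weight `(e^{-Ct} (1 + |x|² + |v|²))^p`, cut off where `e^{Ct} (1 + |x|² + |v|²) > 2S`. -/
noncomputable def cutoffWeight (d : ℕ) (C p S : ℝ) (z : ℝ × Sp d × Sp d) : ℝ :=
  (Real.exp (-(C * z.1)) * (1 + ‖z.2.1‖ ^ 2 + ‖z.2.2‖ ^ 2)) ^ p
    * Real.smoothTransition (2 - Real.exp (C * z.1) * (1 + ‖z.2.1‖ ^ 2 + ‖z.2.2‖ ^ 2) / S)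

theorem contDiff_cutoffWeight (d : ℕ) (C p S : ℝ) : ContDiff ℝ 1 (cutoffWeight d C p S) := by
  have hm : ContDiff ℝ 1 fun z : ℝ × Sp d × Sp d => 1 + ‖z.2.1‖ ^ 2 + ‖z.2.2‖ ^ 2 := by
    have h1 : ContDiff ℝ 1 fun z : ℝ × Sp d × Sp d => ‖z.2.1‖ ^ 2 :=
      (contDiff_norm_sq ℝ).comp (by fun_prop)
    have h2 : ContDiff ℝ 1 fun z : ℝ × Sp d × Sp d => ‖z.2.2‖ ^ 2 :=
      (contDiff_norm_sq ℝ).comp (by fun_prop)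
    exact (contDiff_const.add h1).add h2
  have he : ∀ C : ℝ, ContDiff ℝ 1 fun z : ℝ × Sp d × Sp d => Real.exp (C * z.1) := fun C =>
    Real.contDiff_exp.comp (by fun_prop)
  refine ContDiff.mul (ContDiff.rpow_const_of_ne ?_ fun z => by positivity) ?_
  · simpa using (he (-C)).mul hm
  · exact (Real.smoothTransition.contDiff (n := 1)).comp
      (contDiff_const.sub (((he C).mul hm).div_const S))

theorem cutoffWeight_nonneg (d : ℕ) (C p S : ℝ) (z : ℝ × Sp d × Sp d) :
    0 ≤ cutoffWeight d C p S z :=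
  mul_nonneg (by positivity) (Real.smoothTransition.nonneg _)

theorem cutoffWeight_le (d : ℕ) (C p S : ℝ) (z : ℝ × Sp d × Sp d) :
    cutoffWeight d C p S z ≤ (Real.exp (-(C * z.1)) * (1 + ‖z.2.1‖ ^ 2 + ‖z.2.2‖ ^ 2)) ^ p :=
  mul_le_of_le_one_right (by positivity) (Real.smoothTransition.le_one _)

theorem cutoffWeight_eq_zero {d : ℕ} {C p S : ℝ} (hC : 0 ≤ C) (hS : 1 ≤ S) {t : ℝ} (ht : 0 ≤ t)
    {z : Sp d × Sp d} (hz : 2 * S < ‖z‖) : cutoffWeight d C p S (t, z) = 0 := by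
  have h1 : ‖z‖ ^ 2 ≤ 1 + ‖z.1‖ ^ 2 + ‖z.2‖ ^ 2 := by
    rw [Prod.norm_def]
    rcases max_choice ‖z.1‖ ‖z.2‖ with h | h <;> rw [h] <;> nlinarith [sq_nonneg ‖z.1‖, sq_nonneg ‖z.2‖]
  have h2 : 2 * S ≤ 1 + ‖z.1‖ ^ 2 + ‖z.2‖ ^ 2 := by nlinarith
  have h3 : 2 * S ≤ Real.exp (C * t) * (1 + ‖z.1‖ ^ 2 + ‖z.2‖ ^ 2) :=
    h2.trans (le_mul_of_one_le_left (by positivity) (Real.one_le_exp (by positivity)))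
  rw [cutoffWeight, Real.smoothTransition.zero_of_nonpos, mul_zero]
  rw [sub_nonpos, le_div_iff₀ (by linarith)]
  exact h3

/-- Let m = 1 + |x|² + |v|². Along the transport e^{-Ct} m decreases while e^{Ct} m increases, so
both the power and the cutoff decrease. This is why the two exponentials carry opposite signs. -/
theorem fderiv_cutoffWeight_nonpos {d : ℕ} {C p S : ℝ} (hp : 0 ≤ p) (hS : 0 < S) (t : ℝ)
    (x v F : Sp d)
    (hq : |2 * inner ℝ x v - 2 * inner ℝ v F| ≤ C * (1 + ‖x‖ ^ 2 + ‖v‖ ^ 2)) :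
    fderiv ℝ (cutoffWeight d C p S) (t, x, v) (1, v, -F) ≤ 0 := by
  have h0 := hasDerivAt_comp_line
    (((contDiff_cutoffWeight d C p S).differentiable (by norm_num)) (t, x, v)) F
  have d1 : HasDerivAt (fun s : ℝ => C * (t + s)) (C * 1) 0 :=
    ((hasDerivAt_id (0 : ℝ)).const_add t).const_mul C
  have dq := hasDerivAt_norm_sq_line x v F
  have hst := (Real.smoothTransition.contDiff (n := 1)).differentiable (by norm_num)
  have e1 := (d1.neg.exp.mul dq).rpow_const (p := p) (Or.inl (by
    simp only [Pi.mul_apply]; positivity))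
  have e2 := (hst _).hasDerivAt.comp (0 : ℝ) (((d1.exp.mul dq).div_const S).const_sub 2)
  have e3 := e1.mul e2
  have huniq := h0.unique (e3.congr_of_eventuallyEq (.of_forall fun s => rfl))
  rw [huniq]
  simp only [Pi.mul_apply, Pi.neg_apply, add_zero, zero_smul, sub_zero, mul_one, Function.comp_def]
  set m := 1 + ‖x‖ ^ 2 + ‖v‖ ^ 2 with hm
  have hm0 : 0 < m := by positivity
  have hq1 := (abs_le.1 hq).1
  have hq2 := (abs_le.1 hq).2
  set q := 2 * inner ℝ x v - 2 * inner ℝ v F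
  have hmono : 0 ≤ deriv Real.smoothTransition (2 - Real.exp (C * t) * m / S) :=
    Real.smoothTransition.monotone.deriv_nonneg
  have a1 : Real.exp (-(C * t)) * -C * m + Real.exp (-(C * t)) * q ≤ 0 := by
    have : Real.exp (-(C * t)) * -C * m + Real.exp (-(C * t)) * q
      = Real.exp (-(C * t)) * (q - C * m) := by ring
    rw [this]
    exact mul_nonpos_of_nonneg_of_nonpos (Real.exp_pos _).le (by linarith)
  have a2 : 0 ≤ (Real.exp (C * t) * C * m + Real.exp (C * t) * q) / S := by
    have : Real.exp (C * t) * C * m + Real.exp (C * t) * q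
      = Real.exp (C * t) * (q + C * m) := by ring
    rw [this]
    exact div_nonneg (mul_nonneg (Real.exp_pos _).le (by linarith)) hS.le
  refine add_nonpos ?_ ?_
  · refine mul_nonpos_of_nonpos_of_nonneg ?_ (Real.smoothTransition.nonneg _)
    exact mul_nonpos_of_nonpos_of_nonneg (mul_nonpos_of_nonpos_of_nonneg a1 hp) (by positivity)
  · refine mul_nonpos_of_nonneg_of_nonpos (by positivity) ?_
    exact mul_nonpos_of_nonneg_of_nonpos hmono (neg_nonpos.2 a2)

/-- Phase space moments grow at most exponentially. -/
theorem IsClassicalSolution.exists_moment_le {d : ℕ} {K : Sp d → ℝ}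
    {wB : ℝ → Sp d → Sp d → Sp d} {T : ℝ} {fin : Sp d → Sp d → ℝ} {f : ℝ → Sp d → Sp d → ℝ}
    (hf : IsClassicalSolution K wB T fin f)
    (hskew : ∀ t x, ∃ M : Sp d →L[ℝ] Sp d, (∀ v, wB t x v = M v) ∧ ∀ v, inner ℝ (M v) v = 0)
    {p : ℝ} (hp : 0 ≤ p) :
    ∃ C : ℝ, 0 ≤ C ∧ ∀ t ∈ Icc 0 T,
      ∫⁻ z : Sp d × Sp d, ENNReal.ofReal (f t z.1 z.2
          * (Real.exp (-(C * t)) * (1 + ‖z.1‖ ^ 2 + ‖z.2‖ ^ 2)) ^ p)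
        ≤ ∫⁻ z : Sp d × Sp d, ENNReal.ofReal (fin z.1 z.2 * (1 + ‖z.1‖ ^ 2 + ‖z.2‖ ^ 2) ^ p) := by
  obtain ⟨A, hA, hgrow⟩ := hf.exists_field_growth
  have hwv : ∀ t x v, inner ℝ v (wB t x v) = 0 := fun t x v => by
    obtain ⟨M, hM, hM0⟩ := hskew t x
    rw [hM, real_inner_comm, hM0]
  set C : ℝ := 1 + 2 * A with hC
  have hC0 : 0 ≤ C := by positivity
  refine ⟨C, hC0, fun t ht => ?_⟩
  have h0I : (0 : ℝ) ∈ Icc 0 T := ⟨le_rfl, ht.1.trans ht.2⟩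
  have hcont : ∀ k : ℕ, ∀ s ∈ Icc 0 T, Continuous fun z : Sp d × Sp d =>
      f s z.1 z.2 * cutoffWeight d C p (k + 1) (s, z) := fun k s hs =>
    (hf.continuous_slice hs).mul ((contDiff_cutoffWeight d C p (k + 1)).continuous.comp (by fun_prop))
  have hint : ∀ k : ℕ, ∀ s ∈ Icc 0 T, Integrable fun z : Sp d × Sp d =>
      f s z.1 z.2 * cutoffWeight d C p (k + 1) (s, z) := fun k s hs =>
    integrable_of_continuous_of_eq_zero (hcont k s hs) (R := 2 * (k + 1)) fun z hz => by
      rw [cutoffWeight_eq_zero hC0 (by linarith [Nat.cast_nonneg (α := ℝ) k]) hs.1 hz, mul_zero]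
  have hnn : ∀ k : ℕ, ∀ s ∈ Icc 0 T, ∀ z : Sp d × Sp d,
      0 ≤ f s z.1 z.2 * cutoffWeight d C p (k + 1) (s, z) := fun k s hs z =>
    mul_nonneg (hf.nonneg s hs _ _) (cutoffWeight_nonneg _ _ _ _ _)
  have hk : ∀ k : ℕ, ∫⁻ z : Sp d × Sp d,
      ENNReal.ofReal (f t z.1 z.2 * cutoffWeight d C p (k + 1) (t, z))
        ≤ ∫⁻ z : Sp d × Sp d, ENNReal.ofReal (fin z.1 z.2 * (1 + ‖z.1‖ ^ 2 + ‖z.2‖ ^ 2) ^ p) := by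
    intro k
    have hk1 : (1 : ℝ) ≤ k + 1 := by linarith [Nat.cast_nonneg (α := ℝ) k]
    have h1 := hf.integral_mul_le hskew (contDiff_cutoffWeight d C p (k + 1))
      (R := 2 * (k + 1)) (fun s hs z hz => cutoffWeight_eq_zero hC0 hk1 hs.1 hz)
      (fun s hs x v => fderiv_cutoffWeight_nonpos hp (by positivity) s x v _
        (abs_transport_norm_sq_le hA (hgrow s ⟨hs.1.le, hs.2.le⟩ x)
          (by rw [force, inner_add_right, hwv, add_zero]))) ht
    rw [← ofReal_integral_eq_lintegral_ofReal (hint k t ht) (.of_forall (hnn k t ht))]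
    refine (ENNReal.ofReal_le_ofReal h1).trans ?_
    rw [← hf.initial, ofReal_integral_eq_lintegral_ofReal (hint k 0 h0I) (.of_forall (hnn k 0 h0I))]
    refine lintegral_mono fun z => ENNReal.ofReal_le_ofReal ?_
    refine mul_le_mul_of_nonneg_left ?_ (hf.nonneg 0 h0I _ _)
    simpa using cutoffWeight_le d C p (k + 1) (0, z)
  -- At each point the cutoff is eventually equal to 1, and the bound is uniform in k, so Fatou's
  -- lemma removes the cutoff.
  calc _ = ∫⁻ z : Sp d × Sp d, liminf (fun k : ℕ =>
        ENNReal.ofReal (f t z.1 z.2 * cutoffWeight d C p (k + 1) (t, z))) atTop := by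
        refine lintegral_congr fun z => ?_
        refine (Tendsto.liminf_eq (tendsto_const_nhds.congr' ?_)).symm
        obtain ⟨N, hN⟩ := exists_nat_ge (Real.exp (C * t) * (1 + ‖z.1‖ ^ 2 + ‖z.2‖ ^ 2))
        filter_upwards [eventually_ge_atTop N] with k hk
        have hkN : (N : ℝ) ≤ k := by exact_mod_cast hk
        have hle : Real.exp (C * t) * (1 + ‖z.1‖ ^ 2 + ‖z.2‖ ^ 2) / (k + 1 : ℝ) ≤ 1 := by
          rw [div_le_one (by positivity)]; linarith
        rw [cutoffWeight, Real.smoothTransition.one_of_one_le, mul_one]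
        simp only
        linarith
    _ ≤ liminf (fun k : ℕ => ∫⁻ z : Sp d × Sp d,
        ENNReal.ofReal (f t z.1 z.2 * cutoffWeight d C p (k + 1) (t, z))) atTop :=
        lintegral_liminf_le fun k => (hcont k t ht).measurable.ennreal_ofReal
    _ ≤ _ := by
        refine liminf_le_of_le (by isBoundedDefault) fun b hb => ?_
        obtain ⟨k, hk'⟩ := hb.exists
        exact hk'.trans (hk k)

/-- With M = max(1, a, b) one has 1 + a² + b² ≤ 3M², and M^k is one of the three terms on the right.
-/
theorem one_add_sq_add_sq_rpow_le {k : ℕ} {a b : ℝ} (ha : 0 ≤ a) (hb : 0 ≤ b) :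
    (1 + a ^ 2 + b ^ 2) ^ ((k : ℝ) / 2) ≤ 3 ^ ((k : ℝ) / 2) * (1 + a ^ k + b ^ k) := by
  have hk : 0 ≤ (k : ℝ) / 2 := by positivity
  have key : ∀ M : ℝ, 0 ≤ M → 1 + a ^ 2 + b ^ 2 ≤ 3 * M ^ 2 → M ^ k ≤ 1 + a ^ k + b ^ k →
      (1 + a ^ 2 + b ^ 2) ^ ((k : ℝ) / 2) ≤ 3 ^ ((k : ℝ) / 2) * (1 + a ^ k + b ^ k) := by
    intro M hM h1 h2
    calc _ ≤ (3 * M ^ 2) ^ ((k : ℝ) / 2) := by gcongr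
      _ = 3 ^ ((k : ℝ) / 2) * M ^ k := by
        rw [Real.mul_rpow (by norm_num) (by positivity), ← Real.rpow_natCast M 2,
          ← Real.rpow_mul hM, ← Real.rpow_natCast M k]
        congr 2; push_cast; ring
      _ ≤ _ := by gcongr
  have hak : 0 ≤ a ^ k := by positivity
  have hbk : 0 ≤ b ^ k := by positivity
  rcases le_total a b with hab | hab
  · rcases le_total b 1 with h1 | h1
    · exact key 1 zero_le_one (by nlinarith) (by simp; linarith)
    · exact key b hb (by nlinarith) (by linarith)
  · rcases le_total a 1 with h1 | h1
    · exact key 1 zero_le_one (by nlinarith) (by simp; linarith)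
    · exact key a ha (by nlinarith) (by linarith)

theorem IsClassicalSolution.lintegral_initial_moment_lt_top {d : ℕ} {K : Sp d → ℝ}
    {wB : ℝ → Sp d → Sp d → Sp d} {T : ℝ} {fin : Sp d → Sp d → ℝ} {f : ℝ → Sp d → Sp d → ℝ}
    (hf : IsClassicalSolution K wB T fin f) (hT : 0 < T) {k : ℕ}
    (hv : velMoment k fin < ∞) (hx : posMoment k fin < ∞) :
    ∫⁻ z : Sp d × Sp d, ENNReal.ofReal
      (fin z.1 z.2 * (1 + ‖z.1‖ ^ 2 + ‖z.2‖ ^ 2) ^ ((k : ℝ) / 2)) < ∞ := by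
  have h0 : (0 : ℝ) ∈ Icc 0 T := ⟨le_rfl, hT.le⟩
  have hc := hf.continuous_slice h0
  have hnn := hf.nonneg 0 h0
  obtain ⟨A, -, -, hmass⟩ := hf.exists_bound
  have hm := (hmass 0 h0).trans_lt ENNReal.ofReal_lt_top
  rw [hf.phaseNorm_one h0] at hm
  rw [hf.initial] at hc hnn hm
  calc _ ≤ ∫⁻ z : Sp d × Sp d, ENNReal.ofReal (3 ^ ((k : ℝ) / 2)) * (ENNReal.ofReal (fin z.1 z.2)
        + (ENNReal.ofReal (‖z.1‖ ^ k * fin z.1 z.2) + ENNReal.ofReal (‖z.2‖ ^ k * fin z.1 z.2))) := by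
        refine lintegral_mono fun z => ?_
        have hz := hnn z.1 z.2
        rw [← ENNReal.ofReal_add (by positivity) (by positivity),
          ← ENNReal.ofReal_add hz (by positivity), ← ENNReal.ofReal_mul (by positivity)]
        refine ENNReal.ofReal_le_ofReal ?_
        calc _ ≤ fin z.1 z.2 * (3 ^ ((k : ℝ) / 2) * (1 + ‖z.1‖ ^ k + ‖z.2‖ ^ k)) := by
              gcongr
              exact one_add_sq_add_sq_rpow_le (norm_nonneg _) (norm_nonneg _)
          _ = _ := by ring
    _ = ENNReal.ofReal (3 ^ ((k : ℝ) / 2)) * ((∫⁻ z : Sp d × Sp d, ENNReal.ofReal (fin z.1 z.2))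
        + (posMoment k fin + velMoment k fin)) := by
        rw [lintegral_const_mul', lintegral_add_left, lintegral_add_left]
        · rfl
        · exact Measurable.ennreal_ofReal (Continuous.measurable (by fun_prop))
        · exact Measurable.ennreal_ofReal (Continuous.measurable (by fun_prop))
        · exact ENNReal.ofReal_ne_top
    _ < ∞ := by
        refine ENNReal.mul_lt_top ENNReal.ofReal_lt_top ?_
        exact ENNReal.add_lt_top.2 ⟨hm, ENNReal.add_lt_top.2 ⟨hx, hv⟩⟩

/-! ### The field in dimension three -/

theorem lintegral_ball_norm_rpow_lt_top {s : ℝ} (hs : -3 < s) :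
    ∫⁻ w in Metric.ball (0 : Sp 3) 1, ENNReal.ofReal (‖w‖ ^ s) < ∞ := by
  have h : IntegrableOn (fun w : Sp 3 => ‖w‖ ^ s) (Metric.ball 0 1) := by
    rw [integrableOn_fun_norm_addHaar volume (f := fun r : ℝ => r ^ s)]
    have h1 : IntegrableOn (fun r : ℝ => r ^ (2 + s)) (Ioo 0 1) :=
      ((intervalIntegral.intervalIntegrable_rpow' (a := 0) (b := 1) (by linarith)).1).mono_set
        Ioo_subset_Ioc_self
    refine h1.congr_fun (fun r hr => ?_) measurableSet_Ioo
    simp only [finrank_euclideanSpace, Fintype.card_fin, smul_eq_mul]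
    rw [← Real.rpow_natCast, ← Real.rpow_add hr.1]
    norm_num
  exact h.lintegral_lt_top

/-- In dimension three the field is bounded once the phase space moments of order seven of the
initial datum are finite. The moments propagate by the linear growth of the field, which belongs to
the definition of a classical solution; the size of the datum plays no role. -/
theorem IsClassicalSolution.exists_field_bound_three {K : Sp 3 → ℝ}
    (hK : ∀ x ≠ 0, ‖gradient K x‖ ≤ 1 / ‖x‖ ^ (3 - 1))
    {wB : ℝ → Sp 3 → Sp 3 → Sp 3} {T : ℝ} {fin : Sp 3 → Sp 3 → ℝ} {f : ℝ → Sp 3 → Sp 3 → ℝ}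
    (hf : IsClassicalSolution K wB T fin f) (hT : 0 < T)
    (hskew : ∀ t x, ∃ M : Sp 3 →L[ℝ] Sp 3, (∀ v, wB t x v = M v) ∧ ∀ v, inner ℝ (M v) v = 0)
    (hv : velMoment 7 fin < ∞) (hx : posMoment 7 fin < ∞) :
    ∃ e : ℝ, ∀ t ∈ Icc 0 T, ∀ x, ‖gradConv K (density (f t)) x‖ ≤ e := by
  obtain ⟨A, hA, hfA, hmass⟩ := hf.exists_bound
  obtain ⟨C, hC, hmom⟩ := hf.exists_moment_le hskew (p := ((7 : ℕ) : ℝ) / 2) (by positivity)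
  have hini := hf.lintegral_initial_moment_lt_top hT hv hx
  set I₀ := ∫⁻ z : Sp 3 × Sp 3, ENNReal.ofReal
      (fin z.1 z.2 * (1 + ‖z.1‖ ^ 2 + ‖z.2‖ ^ 2) ^ (((7 : ℕ) : ℝ) / 2))
  have hmom7 : ∀ t ∈ Icc 0 T, ∫⁻ z : Sp 3 × Sp 3, ENNReal.ofReal (f t z.1 z.2 * ‖z.2‖ ^ 7)
      ≤ ENNReal.ofReal (Real.exp (C * T) ^ (((7 : ℕ) : ℝ) / 2)) * I₀ := by
    intro t ht
    refine le_trans ?_ (mul_le_mul_right (hmom t ht) _)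
    rw [← lintegral_const_mul' _ _ ENNReal.ofReal_ne_top]
    refine lintegral_mono fun z => ?_
    have hz := hf.nonneg t ht z.1 z.2
    rw [← ENNReal.ofReal_mul (by positivity)]
    refine ENNReal.ofReal_le_ofReal ?_
    rw [mul_left_comm, ← Real.mul_rpow (by positivity) (by positivity)]
    gcongr
    have h1 : ‖z.2‖ ^ 2 ≤ Real.exp (C * T) * (Real.exp (-(C * t)) * (1 + ‖z.1‖ ^ 2 + ‖z.2‖ ^ 2)) := by
      rw [← mul_assoc, ← Real.exp_add]
      have h2 : 1 ≤ Real.exp (C * T + -(C * t)) :=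
        Real.one_le_exp (by nlinarith [mul_le_mul_of_nonneg_left ht.2 hC])
      calc ‖z.2‖ ^ 2 ≤ 1 * (1 + ‖z.1‖ ^ 2 + ‖z.2‖ ^ 2) := by nlinarith [sq_nonneg ‖z.1‖]
        _ ≤ _ := by gcongr
    calc ‖z.2‖ ^ 7 = (‖z.2‖ ^ 2) ^ (((7 : ℕ) : ℝ) / 2) := by
          rw [← Real.rpow_natCast _ 2, ← Real.rpow_mul (norm_nonneg _), ← Real.rpow_natCast _ 7]
          congr 1; push_cast; ring
      _ ≤ _ := by gcongr
  -- the singular part of the kernel integrated against the slow particles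
  set V : ℝ≥0∞ := volume (Metric.ball (0 : Sp 3) 1)
  -- The exponent is 2 from the kernel plus 3 · 2/7 from the volume of the slow velocities. With
  -- moments of order k it would be 2 + 6/k, which is below 3 exactly for k > 6.
  set J := ∫⁻ w in Metric.ball (0 : Sp 3) 1, ENNReal.ofReal (‖w‖ ^ (-(20 / 7) : ℝ)) with hJ
  have hJfin : J < ∞ := lintegral_ball_norm_rpow_lt_top (by norm_num)
  set D : ℝ≥0∞ := ENNReal.ofReal A * V * J
    + (ENNReal.ofReal (Real.exp (C * T) ^ (((7 : ℕ) : ℝ) / 2)) * I₀ + ENNReal.ofReal A) with hD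
  have hDfin : D < ∞ := by
    refine ENNReal.add_lt_top.2 ⟨ENNReal.mul_lt_top (ENNReal.mul_lt_top ENNReal.ofReal_lt_top
      measure_ball_lt_top) hJfin, ENNReal.add_lt_top.2 ⟨?_, ENNReal.ofReal_lt_top⟩⟩
    exact ENNReal.mul_lt_top ENNReal.ofReal_lt_top hini
  refine ⟨D.toReal, fun t ht x => IsClassicalSolution.norm_gradConv_le_of_fieldMajorant
    ENNReal.toReal_nonneg (le_trans ?_ (ENNReal.ofReal_toReal hDfin.ne).ge)⟩
  -- The threshold |v| = |w|^{-2/7} is where the kernel bound |w|^{-2} equals |v|^7.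
  set slow : Sp 3 → Sp 3 → ℝ≥0∞ := fun w v =>
    (Metric.ball (0 : Sp 3) 1).indicator (fun w => ENNReal.ofReal A * ENNReal.ofReal (‖w‖ ^ (-2 : ℝ))
      * (Metric.closedBall (0 : Sp 3) (‖w‖ ^ (-(2 / 7) : ℝ))).indicator 1 v) w with hslow
  have hft : Measurable fun z : Sp 3 × Sp 3 => ENNReal.ofReal (f t z.1 z.2) :=
    (hf.continuous_slice ht).measurable.ennreal_ofReal
  have hft7 : Measurable fun z : Sp 3 × Sp 3 => ENNReal.ofReal (f t z.1 z.2 * ‖z.2‖ ^ 7) :=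
    ((hf.continuous_slice ht).measurable.mul (by fun_prop)).ennreal_ofReal
  -- Three regimes, one for each summand: near and slow (sup bound of f), near and fast (seventh
  -- moment), far (kernel at most one, so the mass suffices).
  have hpt : ∀ y v, y ≠ x → ENNReal.ofReal (f t y v) * ‖gradient K (x - y)‖ₑ
      ≤ slow (x - y) v + (ENNReal.ofReal (f t y v * ‖v‖ ^ 7) + ENNReal.ofReal (f t y v)) := by
    intro y v hy
    have hw : x - y ≠ 0 := sub_ne_zero.2 hy.symm
    set w := x - y
    have hw0 : 0 < ‖w‖ := norm_pos_iff.2 hw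
    have hfn := hf.nonneg t ht y v
    have hg : ‖gradient K w‖ₑ ≤ ENNReal.ofReal (‖w‖ ^ (-2 : ℝ)) := by
      rw [← ofReal_norm]
      refine ENNReal.ofReal_le_ofReal ((hK w hw).trans (le_of_eq ?_))
      rw [Real.rpow_neg hw0.le, one_div, ← Real.rpow_natCast]; norm_num
    by_cases h1 : ‖w‖ < 1
    · by_cases h2 : ‖v‖ ≤ ‖w‖ ^ (-(2 / 7) : ℝ)
      · refine le_trans ?_ le_self_add
        have hv' : v ∈ Metric.closedBall (0 : Sp 3) (‖w‖ ^ (-(2 / 7) : ℝ)) := by simpa using h2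
        rw [hslow]
        simp only
        rw [indicator_of_mem (by simpa using h1), indicator_of_mem hv', Pi.one_apply, mul_one]
        gcongr
        exact hfA t ht y v
      · refine le_trans ?_ le_add_self
        refine le_trans ?_ le_self_add
        push Not at h2
        calc _ ≤ ENNReal.ofReal (f t y v) * ENNReal.ofReal (‖w‖ ^ (-2 : ℝ)) := by gcongr
          _ = ENNReal.ofReal (f t y v * ‖w‖ ^ (-2 : ℝ)) := (ENNReal.ofReal_mul hfn).symm
          _ ≤ _ := by
            refine ENNReal.ofReal_le_ofReal ?_
            gcongr
            calc ‖w‖ ^ (-2 : ℝ) = (‖w‖ ^ (-(2 / 7) : ℝ)) ^ 7 := by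
                  rw [← Real.rpow_natCast, ← Real.rpow_mul hw0.le]; norm_num
              _ ≤ _ := by gcongr
    · refine le_trans ?_ le_add_self
      refine le_trans ?_ le_add_self
      push Not at h1
      calc _ ≤ ENNReal.ofReal (f t y v) * ENNReal.ofReal (‖w‖ ^ (-2 : ℝ)) := by gcongr
        _ ≤ ENNReal.ofReal (f t y v) * 1 := by
          gcongr
          rw [← ENNReal.ofReal_one]
          exact ENNReal.ofReal_le_ofReal (Real.rpow_le_one_of_one_le_of_nonpos h1 (by norm_num))
        _ = _ := mul_one _
  have hslow_int : ∫⁻ y, ∫⁻ v, slow (x - y) v = ENNReal.ofReal A * V * J := by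
    have h1 : ∀ w, ∫⁻ v, slow w v = ENNReal.ofReal A * V
        * (Metric.ball (0 : Sp 3) 1).indicator (fun w => ENNReal.ofReal (‖w‖ ^ (-(20 / 7) : ℝ))) w := by
      intro w
      by_cases hw : w ∈ Metric.ball (0 : Sp 3) 1
      · simp only [hslow, indicator_of_mem hw]
        rw [lintegral_const_mul' _ _ (ENNReal.mul_ne_top ENNReal.ofReal_ne_top ENNReal.ofReal_ne_top),
          lintegral_indicator_one measurableSet_closedBall,
          Measure.addHaar_closedBall _ _ (by positivity), finrank_euclideanSpace, Fintype.card_fin]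
        rcases eq_or_ne w 0 with rfl | hw0
        · have e1 : (0 : ℝ) ^ (-2 : ℝ) = 0 := Real.zero_rpow (by norm_num)
          have e2 : (0 : ℝ) ^ (-(20 / 7) : ℝ) = 0 := Real.zero_rpow (by norm_num)
          simp [e1, e2]
        · have hw1 : 0 < ‖w‖ := norm_pos_iff.2 hw0
          have e1 : ‖w‖ ^ (-(20 / 7) : ℝ) = ‖w‖ ^ (-2 : ℝ) * (‖w‖ ^ (-(2 / 7) : ℝ)) ^ 3 := by
            rw [← Real.rpow_natCast (‖w‖ ^ (-(2 / 7) : ℝ)), ← Real.rpow_mul hw1.le,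
              ← Real.rpow_add hw1]
            norm_num
          rw [e1, ENNReal.ofReal_mul (by positivity)]
          ring
      · simp [hslow, indicator_of_notMem hw]
    simp_rw [h1]
    have hV : ENNReal.ofReal A * V ≠ ∞ :=
      ENNReal.mul_ne_top ENNReal.ofReal_ne_top measure_ball_lt_top.ne
    rw [lintegral_const_mul' _ _ hV, lintegral_sub_left_eq_self
      (fun w => (Metric.ball (0 : Sp 3) 1).indicator
        (fun w => ENNReal.ofReal (‖w‖ ^ (-(20 / 7) : ℝ))) w) x,
      lintegral_indicator measurableSet_ball]
  have hy : ∀ᵐ y : Sp 3, y ≠ x := by simp [ae_iff]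
  have hk : Measurable fun y : Sp 3 => ‖gradient K (x - y)‖ₑ :=
    ((measurable_gradient K).comp (measurable_const.sub measurable_id)).enorm
  rw [hf.fieldMajorant_eq ht, Measure.volume_eq_prod, lintegral_prod
    (fun z : Sp 3 × Sp 3 => ENNReal.ofReal (f t z.1 z.2) * ‖gradient K (x - z.1)‖ₑ)
    (hft.mul (hk.comp measurable_fst)).aemeasurable]
  have hsum : Measurable fun z : Sp 3 × Sp 3 =>
      ENNReal.ofReal (f t z.1 z.2 * ‖z.2‖ ^ 7) + ENNReal.ofReal (f t z.1 z.2) := hft7.add hft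
  calc _ ≤ ∫⁻ y, ∫⁻ v, slow (x - y) v
        + (ENNReal.ofReal (f t y v * ‖v‖ ^ 7) + ENNReal.ofReal (f t y v)) := by
        refine lintegral_mono_ae ?_
        filter_upwards [hy] with y hyx
        exact lintegral_mono fun v => hpt y v hyx
    _ = ∫⁻ y, ((∫⁻ v, slow (x - y) v)
        + ∫⁻ v, (ENNReal.ofReal (f t y v * ‖v‖ ^ 7) + ENNReal.ofReal (f t y v))) := by
        refine lintegral_congr fun y => lintegral_add_right _ ?_
        exact hsum.comp measurable_prodMk_left
    _ = (∫⁻ y, ∫⁻ v, slow (x - y) v)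
        + ∫⁻ y, ∫⁻ v, (ENNReal.ofReal (f t y v * ‖v‖ ^ 7) + ENNReal.ofReal (f t y v)) :=
        lintegral_add_right _ hsum.lintegral_prod_right'
    _ = ENNReal.ofReal A * V * J + ∫⁻ z : Sp 3 × Sp 3,
        (ENNReal.ofReal (f t z.1 z.2 * ‖z.2‖ ^ 7) + ENNReal.ofReal (f t z.1 z.2)) := by
        rw [hslow_int, Measure.volume_eq_prod, lintegral_prod (fun z : Sp 3 × Sp 3 =>
          ENNReal.ofReal (f t z.1 z.2 * ‖z.2‖ ^ 7) + ENNReal.ofReal (f t z.1 z.2)) hsum.aemeasurable]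
    _ ≤ D := by
        rw [hD, lintegral_add_right _ hft]
        gcongr
        · exact hmom7 t ht
        · rw [← hf.phaseNorm_one ht]
          exact hmass t ht

/-! ### The field in dimension two -/

/-- The bracket `⟨x⟩ = (1 + |x|²)^{1/2}`. -/
noncomputable def bracket {d : ℕ} (x : Sp d) : ℝ := √(1 + ‖x‖ ^ 2)

theorem bracket_sq {d : ℕ} (x : Sp d) : bracket x ^ 2 = 1 + ‖x‖ ^ 2 :=
  Real.sq_sqrt (by positivity)

theorem one_le_bracket {d : ℕ} (x : Sp d) : 1 ≤ bracket x :=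
  Real.one_le_sqrt.2 (by nlinarith [sq_nonneg ‖x‖])

theorem norm_le_bracket {d : ℕ} (x : Sp d) : ‖x‖ ≤ bracket x :=
  Real.le_sqrt_of_sq_le (by linarith)

theorem bracket_le_one_add_norm {d : ℕ} (x : Sp d) : bracket x ≤ 1 + ‖x‖ :=
  Real.sqrt_le_iff.2 ⟨by positivity, by nlinarith [norm_nonneg x]⟩

theorem bracket_le_add_one {d : ℕ} {x y : Sp d} (h : ‖x - y‖ ≤ 1) : bracket y ≤ bracket x + 1 := by
  have h1 : ‖y‖ ≤ ‖x‖ + 1 := by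
    have := norm_sub_norm_le y x
    rw [norm_sub_rev] at this
    linarith
  have h2 := norm_le_bracket x
  have h3 := one_le_bracket x
  refine Real.sqrt_le_iff.2 ⟨by linarith, ?_⟩
  nlinarith [bracket_sq x, norm_nonneg y, norm_nonneg x]

theorem continuous_bracket {d : ℕ} : Continuous (bracket : Sp d → ℝ) := by
  unfold bracket; fun_prop

theorem hasDerivAt_bracket_line {d : ℕ} (x v : Sp d) :
    HasDerivAt (fun s : ℝ => bracket (x + s • v)) (inner ℝ x v / bracket x) 0 := by
  have h2 : HasDerivAt (fun s : ℝ => x + s • v) v 0 := by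
    simpa using ((hasDerivAt_id (0 : ℝ)).smul_const v).const_add x
  have h3 := (h2.norm_sq.const_add 1).sqrt (by simp; positivity)
  refine h3.congr_deriv ?_
  simp only [zero_smul, add_zero]
  rw [mul_div_mul_left _ _ two_ne_zero]
  rfl

/-- The weight `e^{n arsinh ψ}` with `ψ = ⟨v⟩ - R (1 + η ⟨x⟩)`, which is comparable with `ψ^n` for
large `ψ` and bounded for `ψ ≤ 0`. -/
noncomputable def shiftWeight {d : ℕ} (n : ℕ) (η R : ℝ) (x v : Sp d) : ℝ :=
  Real.exp (n * Real.arsinh (bracket v - R * (1 + η * bracket x)))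

/-- Since arsinh is increasing and e^{arsinh y} = y + √(1 + y²), the shift can be dropped. The bound
is uniform in η and R. -/
theorem shiftWeight_le {d : ℕ} (n : ℕ) {η R : ℝ} (hη : 0 ≤ η) (hR : 0 ≤ R) (x v : Sp d) :
    shiftWeight n η R x v ≤ (3 * bracket v) ^ n := by
  have h1 := one_le_bracket v
  have h2 := one_le_bracket x
  have h3 : bracket v - R * (1 + η * bracket x) ≤ bracket v := by
    have : 0 ≤ R * (1 + η * bracket x) := by positivity
    linarith
  have h4 : √(1 + bracket v ^ 2) ≤ 2 * bracket v := Real.sqrt_le_iff.2 ⟨by linarith, by nlinarith⟩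
  calc shiftWeight n η R x v ≤ Real.exp (n * Real.arsinh (bracket v)) := by
        unfold shiftWeight
        gcongr
    _ = (bracket v + √(1 + bracket v ^ 2)) ^ n := by rw [Real.exp_nat_mul, Real.exp_arsinh]
    _ ≤ _ := by
      gcongr
      linarith

/-- At speeds beyond twice the shift ψ ≥ |v|/2, and e^{arsinh ψ} ≥ 2ψ. So the weight controls the
tail of f just as |v|^n does. -/
theorem norm_pow_le_shiftWeight {d : ℕ} (n : ℕ) {η R : ℝ} {x v : Sp d}
    (hv : 2 * (R * (1 + η * bracket x)) ≤ ‖v‖) : ‖v‖ ^ n ≤ shiftWeight n η R x v := by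
  have h1 := norm_le_bracket v
  set ψ := bracket v - R * (1 + η * bracket x) with hψ
  have h2 : ‖v‖ / 2 ≤ ψ := by rw [hψ]; linarith
  have h3 : ψ ≤ √(1 + ψ ^ 2) := Real.le_sqrt_of_sq_le (by linarith)
  unfold shiftWeight
  rw [Real.exp_nat_mul, Real.exp_arsinh]
  gcongr
  linarith

namespace IsClassicalSolution

/-- The weight `shiftWeight` with a shift `R(t)` is almost a supersolution if the field is at most
`ε(t) (1 + η ⟨x⟩)` and `R' ≥ ε + η R²`. -/
theorem mul_shiftWeight_le {d : ℕ} {K : Sp d → ℝ} {wB : ℝ → Sp d → Sp d → Sp d}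
    {T : ℝ} {fin : Sp d → Sp d → ℝ} {f : ℝ → Sp d → Sp d → ℝ}
    (hf : IsClassicalSolution K wB T fin f) (hw : ∀ t x v, inner ℝ v (wB t x v) = 0)
    {t₀ t₁ : ℝ} (h0 : 0 ≤ t₀) (h1 : t₁ ≤ T) (n : ℕ) {η : ℝ} (hη : 0 ≤ η) {R R' ε : ℝ → ℝ}
    (hR : ∀ t, HasDerivAt R (R' t) t) (hRpos : ∀ t ∈ Icc t₀ t₁, 0 ≤ R t)
    (hηR : ∀ t ∈ Icc t₀ t₁, η * R t ≤ 1)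
    (hE : ∀ t ∈ Ioo t₀ t₁, ∀ x, ‖gradConv K (density (f t)) x‖ ≤ ε t * (1 + η * bracket x))
    (hode : ∀ t ∈ Ioo t₀ t₁, ε t + η * R t ^ 2 ≤ R' t) {C₀ : ℝ} (hC₀ : 0 ≤ C₀)
    (hini : ∀ x v, f t₀ x v * shiftWeight n η (R t₀) x v ≤ C₀) :
    ∀ t ∈ Icc t₀ t₁, ∀ x v,
      f t x v * shiftWeight n η (R t) x v ≤ C₀ * Real.exp (n * (t - t₀)) := by
  have hRc : Continuous R := continuous_iff_continuousAt.2 fun t => (hR t).continuousAt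
  refine hf.mul_weight_le hw h0 h1 (W := fun t x v => shiftWeight n η (R t) x v) ?_
    (fun _ _ _ _ => (Real.exp_pos _).le) (CW := 3 ^ n) (N := n) ?_ hC₀ ?_ hini
  · have hb := continuous_bracket (d := d)
    refine Continuous.continuousOn (Real.continuous_exp.comp (continuous_const.mul
      (Real.continuous_arsinh.comp ?_)))
    fun_prop
  · intro t ht x v
    refine (shiftWeight_le n hη (hRpos t ht) x v).trans ?_
    rw [mul_pow]
    have h2 : bracket v ≤ 1 + ‖x‖ ^ 2 + ‖v‖ ^ 2 := by
      nlinarith [one_le_bracket v, bracket_sq v, sq_nonneg ‖x‖]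
    have := one_le_bracket v
    gcongr
  · intro t ht x v
    have htI : t ∈ Icc t₀ t₁ := ⟨ht.1.le, ht.2.le⟩
    set F := force K wB f t x v with hF
    set E := gradConv K (density (f t)) x with hEdef
    have hFE : inner ℝ v F = inner ℝ v E := by
      rw [hF, force, inner_add_right, hw, add_zero]
    have dv : HasDerivAt (fun s : ℝ => bracket (v - s • F)) (-(inner ℝ v F / bracket v)) 0 := by
      have := hasDerivAt_bracket_line v (-F)
      simpa [sub_eq_add_neg, inner_neg_right, neg_div] using this
    have dR : HasDerivAt (fun s : ℝ => R (t + s)) (R' t) 0 := by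
      have := (hR (t + 0)).comp_const_add t 0
      simpa using this
    have dψ := dv.sub (dR.mul (((hasDerivAt_bracket_line x v).const_mul η).const_add 1))
    refine ⟨_, ((dψ.arsinh).const_mul (n : ℝ)).exp, ?_⟩
    simp only [Pi.mul_apply, Pi.sub_apply, add_zero, zero_smul, sub_zero]
    have hbx := one_le_bracket x
    have hbv := one_le_bracket v
    set ψ := bracket v - R t * (1 + η * bracket x) with hψ
    have hsq : 0 < √(1 + ψ ^ 2) := by positivity
    have hψs : |ψ| ≤ √(1 + ψ ^ 2) := Real.abs_le_sqrt (by linarith)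
    have a1 : -(inner ℝ v F / bracket v) ≤ ε t * (1 + η * bracket x) := by
      rw [hFE, ← neg_div, div_le_iff₀ (by linarith)]
      calc -inner ℝ v E ≤ ‖v‖ * ‖E‖ := (neg_le_abs _).trans (abs_real_inner_le_norm v E)
        _ ≤ bracket v * (ε t * (1 + η * bracket x)) := by
          gcongr
          · exact norm_le_bracket v
          · exact hE t ht x
        _ = _ := mul_comm _ _
    have a2 : -(inner ℝ x v / bracket x) ≤ bracket v := by
      rw [← neg_div, div_le_iff₀ (by linarith)]
      calc -inner ℝ x v ≤ ‖x‖ * ‖v‖ := (neg_le_abs _).trans (abs_real_inner_le_norm x v)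
        _ ≤ bracket x * bracket v := by
          gcongr
          · exact norm_le_bracket x
          · exact norm_le_bracket v
        _ = _ := mul_comm _ _
    have hRt := hRpos t htI
    have a3 : R t * η * -(inner ℝ x v / bracket x) ≤ R t * η * bracket v := by gcongr
    have a4 : (ε t + η * R t ^ 2) * (1 + η * bracket x) ≤ R' t * (1 + η * bracket x) := by
      gcongr
      exact hode t ht
    have a5 : R t * η * ψ ≤ √(1 + ψ ^ 2) := by
      calc R t * η * ψ ≤ R t * η * |ψ| := by gcongr; exact le_abs_self _
        _ ≤ 1 * |ψ| := by
          gcongr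
          rw [mul_comm]
          exact hηR t htI
        _ ≤ _ := by linarith
    -- Write ⟨v⟩ = ψ + R (1 + η⟨x⟩) in the term Rη⟨v⟩ produced by the motion in x. The second
    -- summand gives ηR² (1 + η⟨x⟩), which R' absorbs along with ε; the first is Rηψ ≤ √(1 + ψ²),
    -- because ηR ≤ 1.
    have hnum : -(inner ℝ v F / bracket v) - (R' t * (1 + η * bracket x)
        + R t * (η * (inner ℝ x v / bracket x))) ≤ √(1 + ψ ^ 2) := by
      have : R t * η * ψ = R t * η * bracket v - η * R t ^ 2 * (1 + η * bracket x) := by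
        rw [hψ]; ring
      linarith
    have hquot : (√(1 + ψ ^ 2))⁻¹ * (-(inner ℝ v F / bracket v) - (R' t * (1 + η * bracket x)
        + R t * (η * (inner ℝ x v / bracket x)))) ≤ 1 := by
      rw [inv_mul_le_iff₀ hsq, mul_one]
      exact hnum
    have hfin : Real.exp (n * Real.arsinh ψ) * (n * 1) = n * shiftWeight n η (R t) x v := by
      rw [shiftWeight, ← hψ]; ring
    refine le_of_le_of_eq ?_ hfin
    have hn0 : (0 : ℝ) ≤ n := Nat.cast_nonneg n
    gcongr
    simpa using hquot

/-- Set Y = R (1 + η⟨x⟩). Velocities up to 2Y contribute at most A times the area of a disc, of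
order Y². Beyond 2Y the weight leaves a tail that is integrable because n > 2. -/
theorem density_le_of_shiftWeight {K : Sp 2 → ℝ} {wB : ℝ → Sp 2 → Sp 2 → Sp 2}
    {T : ℝ} {fin : Sp 2 → Sp 2 → ℝ} {f : ℝ → Sp 2 → Sp 2 → ℝ}
    (hf : IsClassicalSolution K wB T fin f) {t : ℝ} (ht : t ∈ Icc 0 T) {n : ℕ} (hn : 2 < n)
    {A C η R : ℝ} (hC : 0 ≤ C) (hη : 0 ≤ η) (hR : 1 ≤ R) {x : Sp 2}
    (hfA : ∀ v, f t x v ≤ A) (hfC : ∀ v, f t x v * shiftWeight n η R x v ≤ C) :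
    density (f t) x ≤ (4 * A * volume.real (Metric.ball (0 : Sp 2) 1) + 2 * C * velConst 2 n)
      * (R * (1 + η * bracket x)) ^ 2 := by
  have hbx := one_le_bracket x
  set Y := R * (1 + η * bracket x) with hY
  have hY1 : 1 ≤ Y := by
    have : 0 ≤ η * bracket x := by positivity
    rw [hY]; nlinarith
  have hI1 : Integrable ((Metric.closedBall (0 : Sp 2) (2 * Y)).indicator fun _ => A) :=
    (integrable_indicator_iff measurableSet_closedBall).2
      (integrableOn_const (isCompact_closedBall _ _).measure_lt_top.ne)
  have hI2 := (integrable_one_div_one_add_norm_pow (d := 2) hn).const_mul (2 * C)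
  have hvc := velConst_pos (d := 2) hn
  have hvol : volume.real (Metric.closedBall (0 : Sp 2) (2 * Y))
      = (2 * Y) ^ 2 * volume.real (Metric.ball (0 : Sp 2) 1) := by
    rw [measureReal_def, Measure.addHaar_closedBall _ _ (by positivity), finrank_euclideanSpace,
      Fintype.card_fin, ENNReal.toReal_mul, ENNReal.toReal_ofReal (by positivity), measureReal_def]
  calc density (f t) x
      ≤ ∫ v, ((Metric.closedBall (0 : Sp 2) (2 * Y)).indicator (fun _ => A) v
          + 2 * C * (1 / (1 + ‖v‖ ^ n))) := by
        refine integral_mono (hf.density_exists t ht x) (hI1.add hI2) fun v => ?_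
        by_cases hv : v ∈ Metric.closedBall (0 : Sp 2) (2 * Y)
        · simp only [indicator_of_mem hv]
          have : 0 ≤ 2 * C * (1 / (1 + ‖v‖ ^ n)) := by positivity
          linarith [hfA v]
        · simp only [indicator_of_notMem hv, zero_add]
          have hv' : 2 * Y ≤ ‖v‖ := by
            simp only [Metric.mem_closedBall, dist_zero_right, not_le] at hv
            exact hv.le
          have h1 : ‖v‖ ^ n ≤ shiftWeight n η R x v := norm_pow_le_shiftWeight n hv'
          have h2 : 1 ≤ ‖v‖ ^ n := one_le_pow₀ (by linarith)
          rw [mul_one_div, le_div_iff₀ (by positivity)]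
          have hfn := hf.nonneg t ht x v
          have h3 : f t x v * ‖v‖ ^ n ≤ C := (by gcongr : _ ≤ _).trans (hfC v)
          nlinarith
    _ = 4 * A * volume.real (Metric.ball (0 : Sp 2) 1) * Y ^ 2 + 2 * C * velConst 2 n := by
        rw [integral_add hI1 hI2, integral_indicator measurableSet_closedBall, setIntegral_const,
          hvol, integral_const_mul, smul_eq_mul, velConst]
        ring
    _ ≤ _ := by
        have : 2 * C * velConst 2 n * 1 ≤ 2 * C * velConst 2 n * Y ^ 2 := by
          gcongr
          nlinarith
        linarith

end IsClassicalSolution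

/-- Within distance ℓ the density is at most M and the weak L² bound makes the integral of |∇K| of
order ℓ; farther away |∇K| ≤ 1/ℓ meets the mass. Only a local bound of ρ is required, since the
available one grows with x. -/
theorem fieldMajorant_le_of_local_bound {K : Sp 2 → ℝ}
    (hK : ∀ x ≠ 0, ‖gradient K x‖ ≤ 1 / ‖x‖ ^ (2 - 1)) {ρ : Sp 2 → ℝ} {A M ℓ : ℝ} {x : Sp 2}
    (hA : ∫⁻ y, ‖ρ y‖ₑ ≤ ENNReal.ofReal A) (hA0 : 0 ≤ A) (hℓ : 0 < ℓ) (hM0 : 0 ≤ M)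
    (hM : ∀ y, ‖x - y‖ < ℓ → ‖ρ y‖ ≤ M) :
    fieldMajorant K ρ x ≤ ENNReal.ofReal (M * (2 * (weakLpNorm 2 (gradient K)).toReal
      * volume.real (Metric.ball (0 : Sp 2) 1) ^ (1 / 2 : ℝ) * ℓ) + A / ℓ) := by
  have hN : weakLpNorm 2 (gradient K) < ∞ := by
    simpa [bExp] using weakLpNorm_gradient_lt_top (Or.inl rfl) hK
  set N := (weakLpNorm 2 (gradient K)).toReal
  have hNe : weakLpNorm 2 (gradient K) = ENNReal.ofReal N := (ENNReal.ofReal_toReal hN.ne).symm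
  set V := volume.real (Metric.ball (0 : Sp 2) 1) with hV
  set near : Sp 2 → ℝ≥0∞ := (Metric.ball (0 : Sp 2) ℓ).indicator fun w => ‖gradient K w‖ₑ
  have hnear_meas : Measurable near := (measurable_gradient K).enorm.indicator measurableSet_ball
  have hpt : ∀ y, ‖ρ y‖ₑ * ‖gradient K (x - y)‖ₑ
      ≤ ENNReal.ofReal M * near (x - y) + ENNReal.ofReal (1 / ℓ) * ‖ρ y‖ₑ := by
    intro y
    by_cases hy : ‖x - y‖ < ℓ
    · refine le_trans ?_ le_self_add
      have : near (x - y) = ‖gradient K (x - y)‖ₑ := indicator_of_mem (by simpa using hy) _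
      rw [this]
      gcongr
      rw [← ofReal_norm]
      exact ENNReal.ofReal_le_ofReal (hM y hy)
    · refine le_trans ?_ le_add_self
      push Not at hy
      rw [mul_comm]
      gcongr
      rw [← ofReal_norm]
      refine ENNReal.ofReal_le_ofReal ((hK _ ?_).trans ?_)
      · exact norm_pos_iff.1 (hℓ.trans_le hy)
      · norm_num only [Nat.reduceSub, pow_one]
        gcongr
  have hball : volume (Metric.ball (0 : Sp 2) ℓ) = ENNReal.ofReal (ℓ ^ 2 * V) := by
    rw [Measure.addHaar_ball _ _ hℓ.le, finrank_euclideanSpace, Fintype.card_fin,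
      ENNReal.ofReal_mul (by positivity), hV, ofReal_measureReal measure_ball_lt_top.ne]
  have hnear : ∫⁻ w, near w ≤ ENNReal.ofReal (2 * N * V ^ (1 / 2 : ℝ) * ℓ) := by
    rw [lintegral_indicator measurableSet_ball]
    refine (setLIntegral_enorm_le_weakLpNorm one_lt_two (measurable_gradient K) hN.ne _).trans
      (le_of_eq ?_)
    have hV0 : 0 ≤ V := measureReal_nonneg
    have hN0 : 0 ≤ N := ENNReal.toReal_nonneg
    rw [hball, hNe, ENNReal.ofReal_rpow_of_nonneg (by positivity) (by norm_num),
      ← ENNReal.ofReal_mul (by norm_num), ← ENNReal.ofReal_mul (by positivity)]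
    congr 1
    norm_num only
    rw [Real.mul_rpow (by positivity) hV0, ← Real.sqrt_eq_rpow, Real.sqrt_sq hℓ.le]
    ring
  have hV0 : 0 ≤ V := measureReal_nonneg
  have hN0 : 0 ≤ N := ENNReal.toReal_nonneg
  calc fieldMajorant K ρ x
      ≤ ∫⁻ y, (ENNReal.ofReal M * near (x - y) + ENNReal.ofReal (1 / ℓ) * ‖ρ y‖ₑ) :=
        lintegral_mono hpt
    _ = ENNReal.ofReal M * (∫⁻ w, near w) + ENNReal.ofReal (1 / ℓ) * ∫⁻ y, ‖ρ y‖ₑ := by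
        have hm : Measurable fun y => ENNReal.ofReal M * near (x - y) :=
          (hnear_meas.comp (measurable_const.sub measurable_id)).const_mul _
        rw [lintegral_add_left hm,
          lintegral_const_mul' _ _ ENNReal.ofReal_ne_top,
          lintegral_const_mul' _ _ ENNReal.ofReal_ne_top, lintegral_sub_left_eq_self near x]
    _ ≤ ENNReal.ofReal M * ENNReal.ofReal (2 * N * V ^ (1 / 2 : ℝ) * ℓ)
        + ENNReal.ofReal (1 / ℓ) * ENNReal.ofReal A := by gcongr
    _ = _ := by
        rw [← ENNReal.ofReal_mul hM0, ← ENNReal.ofReal_mul (by positivity),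
          ← ENNReal.ofReal_add (by positivity) (by positivity)]
        congr 1
        ring

/-- A bound of the solution by the weight `shiftWeight` bounds the field. -/
theorem IsClassicalSolution.exists_field_le_of_shiftWeight {K : Sp 2 → ℝ}
    (hK : ∀ x ≠ 0, ‖gradient K x‖ ≤ 1 / ‖x‖ ^ (2 - 1))
    {wB : ℝ → Sp 2 → Sp 2 → Sp 2} {T : ℝ} {fin : Sp 2 → Sp 2 → ℝ} {f : ℝ → Sp 2 → Sp 2 → ℝ}
    (hf : IsClassicalSolution K wB T fin f) {n : ℕ} (hn : 2 < n) {C : ℝ} (hC : 0 ≤ C) :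
    ∃ C₁ : ℝ, 0 ≤ C₁ ∧ ∀ t ∈ Icc 0 T, ∀ η R : ℝ, 0 ≤ η → η ≤ 1 → 1 ≤ R →
      (∀ x v, f t x v * shiftWeight n η R x v ≤ C) → ∀ x,
      ‖gradConv K (density (f t)) x‖ ≤ C₁ * (R * (1 + η * bracket x)) := by
  obtain ⟨A, hA, hfA, hmass⟩ := hf.exists_bound
  have hvc := velConst_pos (d := 2) hn
  set V := volume.real (Metric.ball (0 : Sp 2) 1) with hV
  have hV0 : 0 ≤ V := measureReal_nonneg
  set N := (weakLpNorm 2 (gradient K)).toReal with hN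
  have hN0 : 0 ≤ N := ENNReal.toReal_nonneg
  set C₂ : ℝ := 4 * A * V + 2 * C * velConst 2 n with hC₂
  have hC₂0 : 0 ≤ C₂ := by positivity
  have hbr := one_le_bracket (d := 2)
  refine ⟨8 * C₂ * N * V ^ (1 / 2 : ℝ) + A, by positivity, ?_⟩
  intro t ht η R hη hη1 hR hfW x
  set Y := R * (1 + η * bracket x) with hY
  have hY1 : 1 ≤ Y := by
    have : 0 ≤ η * bracket x := mul_nonneg hη (by linarith [hbr x])
    rw [hY]; nlinarith
  -- The radius ℓ = 1/Y balances Y² ℓ against A/ℓ, so the field is of order Y. As ℓ ≤ 1, the bracket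
  -- changes by at most 1 and Y at most doubles within this distance.
  have hρ : ∀ y, ‖x - y‖ < 1 / Y → ‖density (f t) y‖ ≤ C₂ * (4 * Y ^ 2) := by
    intro y hy
    have hy1 : ‖x - y‖ ≤ 1 := hy.le.trans ((div_le_one (by linarith)).2 hY1)
    rw [Real.norm_of_nonneg (hf.density_nonneg ht y)]
    refine (hf.density_le_of_shiftWeight ht hn hC hη hR (fun v => hfA t ht y v)
      (hfW y)).trans ?_
    have hYy : R * (1 + η * bracket y) ≤ 2 * Y := by
      have h1 : η * bracket y ≤ η * (bracket x + 1) := by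
        gcongr
        exact bracket_le_add_one hy1
      have h2 : 0 ≤ η * bracket x := mul_nonneg hη (by linarith [hbr x])
      have h3 : R * (1 + η * bracket y) ≤ R * (2 * (1 + η * bracket x)) := by
        gcongr
        linarith
      rw [hY]; linarith
    have h0 : 0 ≤ R * (1 + η * bracket y) := by
      have := mul_nonneg hη (zero_le_one.trans (hbr y))
      positivity
    rw [← hV, ← hC₂]
    gcongr
    nlinarith
  have hmaj := fieldMajorant_le_of_local_bound hK (x := x)
    ((hf.lintegral_enorm_density ht).trans_le (hmass t ht)) hA (by positivity) (by positivity) hρ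
  refine IsClassicalSolution.norm_gradConv_le_of_fieldMajorant (by positivity)
    (hmaj.trans (ENNReal.ofReal_le_ofReal (le_of_eq ?_)))
  rw [← hN, ← hV]
  field_simp
  ring

/-- The constant depends on neither η nor R, so one starting bound serves the barriers for all η.
The factor 6^n is 3^n from the weight times 2^n from (1 + |v|)^n ≤ 2^n (1 + |v|^n). -/
theorem IsClassicalSolution.initial_mul_shiftWeight_le {d : ℕ} {K : Sp d → ℝ}
    {wB : ℝ → Sp d → Sp d → Sp d} {T : ℝ} {fin : Sp d → Sp d → ℝ} {f : ℝ → Sp d → Sp d → ℝ}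
    (hf : IsClassicalSolution K wB T fin f) (hT : 0 < T) {n : ℕ} (hQ : weightedSup n fin < ∞)
    {η R : ℝ} (hη : 0 ≤ η) (hR : 0 ≤ R) (x v : Sp d) :
    f 0 x v * shiftWeight n η R x v ≤ 6 ^ n * (weightedSup n fin).toReal := by
  have h1 := hf.weight_mul_initial_le hT hQ x v
  have h2 := hf.nonneg 0 ⟨le_rfl, hT.le⟩ x v
  rw [hf.initial] at h2 ⊢
  have h3 : (3 * bracket v) ^ n ≤ 6 ^ n * (1 + ‖v‖ ^ n) := by
    calc (3 * bracket v) ^ n ≤ (3 * (1 + ‖v‖)) ^ n := by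
          have := one_le_bracket v
          gcongr
          exact bracket_le_one_add_norm v
      _ = 3 ^ n * (1 + ‖v‖) ^ n := mul_pow _ _ _
      _ ≤ 3 ^ n * (2 ^ (n - 1) * (1 ^ n + ‖v‖ ^ n)) := by
          gcongr
          exact add_pow_le zero_le_one (norm_nonneg v) n
      _ ≤ 3 ^ n * (2 ^ n * (1 + ‖v‖ ^ n)) := by
          rw [one_pow]
          gcongr
          · exact one_le_two
          · exact Nat.sub_le n 1
      _ = _ := by rw [← mul_assoc, ← mul_pow]; norm_num
  calc fin x v * shiftWeight n η R x v ≤ fin x v * (6 ^ n * (1 + ‖v‖ ^ n)) := by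
        gcongr
        exact (shiftWeight_le n hη hR x v).trans h3
    _ = 6 ^ n * ((1 + ‖v‖ ^ n) * fin x v) := by ring
    _ ≤ _ := by gcongr

/-- Propagation of the weight bound, in time steps of a length depending on `η`. -/
theorem IsClassicalSolution.mul_shiftWeight_exp_le {d : ℕ} {K : Sp d → ℝ}
    {wB : ℝ → Sp d → Sp d → Sp d} {T : ℝ} {fin : Sp d → Sp d → ℝ} {f : ℝ → Sp d → Sp d → ℝ}
    (hf : IsClassicalSolution K wB T fin f) (hw : ∀ t x v, inner ℝ v (wB t x v) = 0)
    (hT : 0 < T) {n : ℕ} {C₀ C₁ : ℝ} (hC₀0 : 0 ≤ C₀) (hC₁0 : 0 ≤ C₁)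
    (hfield : ∀ t ∈ Icc 0 T, ∀ η R : ℝ, 0 ≤ η → η ≤ 1 → 1 ≤ R →
      (∀ x v, f t x v * shiftWeight n η R x v ≤ C₀ * Real.exp (n * T)) → ∀ x,
      ‖gradConv K (density (f t)) x‖ ≤ C₁ * (R * (1 + η * bracket x)))
    {η : ℝ} (hη : 0 < η) (hηr : η * (2 * Real.exp ((2 * C₁ + 1) * T)) ≤ 1)
    (hstart : ∀ x v, f 0 x v * shiftWeight n η 1 x v ≤ C₀) :
    ∀ t ∈ Icc 0 T, ∀ x v,
      f t x v * shiftWeight n η (Real.exp ((2 * C₁ + 1) * t)) x v ≤ C₀ * Real.exp (n * t) := by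
  obtain ⟨A₁, hA₁, hgrow⟩ := hf.exists_field_growth
  have hbr := one_le_bracket (d := d)
  -- The term 2C₁ covers the field produced by a shift of at most 2r, and the 1 covers ηr² ≤ r.
  set κ : ℝ := 2 * C₁ + 1 with hκ
  set r : ℝ → ℝ := fun t => Real.exp (κ * t) with hr
  have hr1 : ∀ t, 0 ≤ t → 1 ≤ r t := fun t ht => Real.one_le_exp (by positivity)
  have hrT : ∀ t ∈ Icc 0 T, r t ≤ r T := fun t ht =>
    Real.exp_le_exp.2 (mul_le_mul_of_nonneg_left ht.2 (by positivity))
  have hrmono : Monotone r := fun a b hab =>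
    Real.exp_le_exp.2 (mul_le_mul_of_nonneg_left hab (by positivity))
  have hηr : η * (2 * r T) ≤ 1 := hηr
  have hr00 : r 0 = 1 := by simp [hr]
  have hrd : ∀ t, HasDerivAt r (κ * r t) t := fun t => by
    have := ((hasDerivAt_id t).const_mul κ).exp
    simpa [hr, mul_comm] using this
  have hexpT : ∀ t ∈ Icc 0 T, C₀ * Real.exp (n * t) ≤ C₀ * Real.exp (n * T) := fun t ht => by
    gcongr
    exact ht.2
  change ∀ t ∈ Icc 0 T, ∀ x v, f t x v * shiftWeight n η (r t) x v ≤ C₀ * Real.exp (n * t)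
  clear_value r κ
  have hrT1 := hr1 T hT.le
  have hη1 : η ≤ 1 := by nlinarith
  -- A slope that beats the growth hypothesis on the field, written as (A₁/η)(1 + η⟨x⟩), together
  -- with ηR² ≤ R ≤ 2r(T). In a time step of length 1/Λ the linear shift rises by at most 1 ≤ r(t₀),
  -- so it at most doubles.
  set Λ : ℝ := A₁ / η + 2 * r T with hΛ
  have hΛ0 : 0 < Λ := by positivity
  have hstep : ∀ j : ℕ, ∀ t ∈ Icc 0 T, t ≤ j / Λ → ∀ x v,
      f t x v * shiftWeight n η (r t) x v ≤ C₀ * Real.exp (n * t) := by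
    intro j
    induction j with
    | zero =>
      intro t ht ht0 x v
      have : t = 0 := le_antisymm (by simpa using ht0) ht.1
      subst this
      simpa [hr00] using hstart x v
    | succ j ih =>
      intro t ht htj
      rcases le_total t (j / Λ) with hle | hle
      · exact ih t ht hle
      set t₀ : ℝ := j / Λ
      have ht₀0 : 0 ≤ t₀ := by positivity
      have ht₀ : t₀ ∈ Icc 0 T := ⟨ht₀0, hle.trans ht.2⟩
      have hlen : Λ * (t - t₀) ≤ 1 := by
        have : t - t₀ ≤ 1 / Λ := by
          have e : ((j + 1 : ℕ) : ℝ) / Λ = t₀ + 1 / Λ := by push_cast; ring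
          linarith
        calc Λ * (t - t₀) ≤ Λ * (1 / Λ) := by gcongr
          _ = 1 := mul_one_div_cancel hΛ0.ne'
      have hr0 := hr1 t₀ ht₀0
      have hini := ih t₀ ht₀ le_rfl
      have hsubI : ∀ s ∈ Icc t₀ t, s ∈ Icc 0 T := fun s hs =>
        ⟨ht₀0.trans hs.1, hs.2.trans ht.2⟩
      set R : ℝ → ℝ := fun s => r t₀ + Λ * (s - t₀) with hRdef
      have hRs : ∀ s ∈ Icc t₀ t, 1 ≤ R s ∧ R s ≤ 2 * r t₀ := fun s hs => by
        have h1 : 0 ≤ Λ * (s - t₀) := mul_nonneg hΛ0.le (by linarith [hs.1])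
        have h2 : Λ * (s - t₀) ≤ Λ * (t - t₀) := by gcongr; exact hs.2
        constructor <;> simp only [hRdef] <;> linarith
      have hRd : ∀ s, HasDerivAt R Λ s := fun s =>
        ((((hasDerivAt_id s).sub_const t₀).const_mul Λ).const_add (r t₀)).congr_deriv (mul_one Λ)
      have hηR : ∀ s ∈ Icc t₀ t, η * R s ≤ 1 := fun s hs => by
        have := (hRs s hs).2
        have := hrT t₀ ht₀
        calc η * R s ≤ η * (2 * r T) := by gcongr; linarith
          _ ≤ 1 := hηr
      -- Crude pass: the growth constant A₁ of the particular solution yields some barrier on the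
      -- step. Through it A₁ affects only the length of the step.
      have hcrude := hf.mul_shiftWeight_le hw ht₀0 ht.2 n hη.le (R := R) (R' := fun _ => Λ)
          (C₀ := C₀ * Real.exp (n * t₀))
        (ε := fun _ => A₁ / η) hRd (fun s hs => by linarith [(hRs s hs).1]) hηR
        (fun s hs x => by
          refine (hgrow s (hsubI s ⟨hs.1.le, hs.2.le⟩) x).trans ?_
          rw [div_mul_eq_mul_div, le_div_iff₀ hη, mul_assoc]
          have := norm_le_bracket x
          have h5 : η * ‖x‖ ≤ η * bracket x := by gcongr
          gcongr
          linarith)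
        (fun s hs => by
          have hsI : s ∈ Icc t₀ t := ⟨hs.1.le, hs.2.le⟩
          have h1 := hηR s hsI
          have h2 := hRs s hsI
          have h3 := hrT t₀ ht₀
          have h4 : η * R s ^ 2 ≤ R s := by
            calc η * R s ^ 2 = (η * R s) * R s := by ring
              _ ≤ 1 * R s := by gcongr; linarith
              _ = R s := one_mul _
          rw [hΛ]; linarith)
        (by positivity) (fun x v => by simpa [hRdef] using hini x v)
      have hE : ∀ s ∈ Icc t₀ t, ∀ x,
          ‖gradConv K (density (f s)) x‖ ≤ 2 * C₁ * r s * (1 + η * bracket x) := by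
        intro s hs x
        have hRs' := hRs s hs
        have hb := hbr x
        have h1 := hfield s (hsubI s hs) η (R s) hη.le hη1 hRs'.1 (fun x v => by
          refine (hcrude s hs x v).trans (le_trans (le_of_eq ?_) (hexpT s (hsubI s hs)))
          rw [mul_assoc, ← Real.exp_add]
          congr 2; ring) x
        refine h1.trans ?_
        have h2 : R s ≤ 2 * r s := hRs'.2.trans (by linarith [hrmono hs.1])
        calc C₁ * (R s * (1 + η * bracket x)) ≤ C₁ * (2 * r s * (1 + η * bracket x)) := by gcongr
          _ = _ := by ring
      -- Fine pass: it restarts from the same bound at t₀, now with the field estimate just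
      -- obtained, and returns the shift r itself. Nothing is lost from step to step, so their
      -- number, which grows as η → 0, is harmless.
      have hfine := hf.mul_shiftWeight_le hw ht₀0 ht.2 n hη.le (R := r)
          (C₀ := C₀ * Real.exp (n * t₀))
        (R' := fun s => κ * r s) (ε := fun s => 2 * C₁ * r s) hrd
        (fun s hs => zero_le_one.trans (hr1 s (hsubI s hs).1))
        (fun s hs => by
          have := hrT s (hsubI s hs)
          calc η * r s ≤ η * (2 * r T) := by gcongr; linarith
            _ ≤ 1 := hηr)
        (fun s hs x => hE s ⟨hs.1.le, hs.2.le⟩ x)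
        (fun s hs => by
          have h1 := hrT s (hsubI s ⟨hs.1.le, hs.2.le⟩)
          have h0 : 0 < r s := zero_lt_one.trans_le (hr1 s (hsubI s ⟨hs.1.le, hs.2.le⟩).1)
          have h2 : η * r s ≤ 1 := le_trans (by gcongr; linarith) hηr
          have h4 : η * r s ^ 2 ≤ r s := by
            calc η * r s ^ 2 = (η * r s) * r s := by ring
              _ ≤ 1 * r s := by gcongr
              _ = r s := one_mul _
          rw [hκ]; linarith)
        (by positivity) hini
      intro x v
      refine (hfine t ⟨hle, le_rfl⟩ x v).trans (le_of_eq ?_)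
      rw [mul_assoc, ← Real.exp_add]
      congr 2; ring
  intro t ht
  obtain ⟨j, hj⟩ := exists_nat_ge (t * Λ)
  exact hstep j t ht ((le_div_iff₀ hΛ0).2 hj)

/-- In dimension two the field of a classical solution is bounded. -/
theorem IsClassicalSolution.exists_field_bound_two {K : Sp 2 → ℝ}
    (hK : ∀ x ≠ 0, ‖gradient K x‖ ≤ 1 / ‖x‖ ^ (2 - 1))
    {wB : ℝ → Sp 2 → Sp 2 → Sp 2} {T : ℝ} {fin : Sp 2 → Sp 2 → ℝ} {f : ℝ → Sp 2 → Sp 2 → ℝ}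
    (hf : IsClassicalSolution K wB T fin f) (hw : ∀ t x v, inner ℝ v (wB t x v) = 0)
    (hT : 0 < T) {n : ℕ} (hn : 2 < n) (hQ : weightedSup n fin < ∞) :
    ∃ e : ℝ, ∀ t ∈ Icc 0 T, ∀ x, ‖gradConv K (density (f t)) x‖ ≤ e := by
  set C₀ : ℝ := 6 ^ n * (weightedSup n fin).toReal
  have hC₀ : 0 ≤ C₀ := by positivity
  obtain ⟨C₁, hC₁, hfield⟩ :=
    hf.exists_field_le_of_shiftWeight hK hn (C := C₀ * Real.exp (n * T)) (by positivity)
  have hbarrier := fun (η : ℝ) (hη : 0 < η) hηr => hf.mul_shiftWeight_exp_le hw hT hC₀ hC₁ hfield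
    hη hηr (hf.initial_mul_shiftWeight_le hT hQ hη.le zero_le_one)
  set r : ℝ → ℝ := fun t => Real.exp ((2 * C₁ + 1) * t)
  have hr1 : ∀ t, 0 ≤ t → 1 ≤ r t := fun t ht => Real.one_le_exp (by positivity)
  refine ⟨C₁ * (r T * 2), fun t ht x => ?_⟩
  have hrT1 := hr1 T hT.le
  have hb := one_le_bracket x
  -- The parameter is adapted to the point x: small enough for the barrier to hold up to T, and with
  -- η⟨x⟩ ≤ 1, so that the field bound at x does not depend on x.
  set η : ℝ := 1 / (2 * r T * bracket x) with hη
  have hη0 : 0 < η := by positivity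
  have hηr : η * (2 * r T) ≤ 1 := by
    have : η * (2 * r T) = 1 / bracket x := by rw [hη]; field_simp
    rw [this, div_le_one (by linarith)]
    exact hb
  have hηb : η * bracket x ≤ 1 := by
    have : η * bracket x = 1 / (2 * r T) := by rw [hη]; field_simp
    rw [this, div_le_one (by linarith)]
    linarith
  have hη1 : η ≤ 1 := by nlinarith
  have h1 := hfield t ht η (r t) hη0.le hη1 (hr1 t ht.1)
    (fun x v => (hbarrier η hη0 hηr t ht x v).trans (by gcongr; exact ht.2)) x
  refine h1.trans ?_
  have h2 : r t ≤ r T := Real.exp_le_exp.2 (mul_le_mul_of_nonneg_left ht.2 (by positivity))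
  have h3 : 0 ≤ r t := (Real.exp_pos _).le
  gcongr
  linarith

/-! ### The Lorentz forces and the main theorem -/

theorem inner_wedge2_self (v : Sp 2) (β : ℝ) : inner ℝ v (wedge2 v β) = 0 := by
  simp [wedge2, PiLp.inner_apply, Fin.sum_univ_two]
  ring

theorem exists_skew_wedge3 (w : Sp 3) :
    ∃ M : Sp 3 →L[ℝ] Sp 3, (∀ v, wedge3 v w = M v) ∧ ∀ v, inner ℝ (M v) v = 0 := by
  refine ⟨LinearMap.toContinuousLinearMap
    { toFun := fun v => wedge3 v w
      map_add' := fun v v' => by simp [wedge3]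
      map_smul' := fun c v => by simp [wedge3] }, fun v => rfl, fun v => ?_⟩
  simp [wedge3, PiLp.inner_apply, Fin.sum_univ_three, crossProduct]
  ring

theorem abs_eq_one_of_sign {σ : ℝ} (h : σ = 1 ∨ σ = -1) : |σ| = 1 := by
  rcases h with rfl | rfl <;> simp

theorem mainTheorem5 :
    (∀ (σ : ℝ), σ = 1 ∨ σ = -1 →
      ∀ (T : ℝ), 0 < T →
      ∀ (n : ℕ), (2 : ℝ) * (bConj 2 - 1) < n →
      ∀ (B : ℝ → Sp 2 → ℝ) (fin : Sp 2 → Sp 2 → ℝ) (Min : ℕ → ℝ) (f : ℝ → Sp 2 → Sp 2 → ℝ),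
      (∀ x v, 0 ≤ fin x v) → phaseNorm 1 fin < ⊤ → phaseNorm ⊤ fin < ⊤ →
      (∀ k ≤ n, 0 < Min k ∧ velMoment k fin ≤ ENNReal.ofReal (Min k)) →
      weightedSup n fin < ⊤ →
      IsClassicalSolution (coulomb2 σ) (fun t x v => wedge2 v (B t x)) T fin f →
      DensityBounds (coulomb2 σ) n T fin f)
    ∧
    (∀ (σ : ℝ), σ = 1 ∨ σ = -1 → ∀ (κ : ℝ), 0 < κ →
      ∀ (c : ℝ), c ∈ Set.Ioo (7 / 5 : ℝ) (3 / 2) → ∀ (B₀ : ℝ), 0 < B₀ →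
      ∃ ε₀ : ℝ, 0 < ε₀ ∧
      ∀ (T : ℝ), 0 < T →
      ∀ (n : ℕ), 4 ≤ n → (3 : ℝ) * (bConj 3 - 1) < n →
      ∀ (B : ℝ → Sp 3 → Sp 3) (fin : Sp 3 → Sp 3 → ℝ) (Min Nin : ℕ → ℝ)
        (f : ℝ → Sp 3 → Sp 3 → ℝ),
      (∀ t ∈ Set.Ioc 0 T,
        MeasureTheory.eLpNorm (fun x => wedge3 x (B t x)) ⊤ MeasureTheory.volume
            ≤ ENNReal.ofReal (B₀ * t ^ (-(3 / c - 1)))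
        ∧ MeasureTheory.eLpNorm (B t) ⊤ MeasureTheory.volume
            ≤ ENNReal.ofReal (B₀ * t ^ (-(3 / c - 1)))) →
      (∀ x v, 0 ≤ fin x v) → phaseNorm 1 fin < ⊤ → phaseNorm ⊤ fin < ⊤ →
      (∀ k ≤ n, 0 < Min k ∧ velMoment k fin ≤ ENNReal.ofReal (Min k)) →
      (∀ k ≤ n, 0 < Nin k ∧ posMoment k fin ≤ ENNReal.ofReal (Nin k)) →
      max (phaseNorm ⊤ fin) (phaseNorm 1 fin) + velMoment 4 fin + posMoment 4 fin
        ≤ ENNReal.ofReal ε₀ →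
      weightedSup n fin < ⊤ →
      IsClassicalSolution (yukawa3 σ κ) (fun t x v => wedge3 v (B t x)) T fin f →
      DensityBounds (yukawa3 σ κ) n T fin f) := by
  refine ⟨?_, ?_⟩
  · intro σ hσ T hT n hn B fin _ f _ _ _ _ hQ hf
    -- Here b' = 2, so d (b' - 1) = 2.
    have hn2 : 2 < n := by
      norm_num [bConj, bExp] at hn
      exact_mod_cast hn
    have hK : ∀ x ≠ 0, ‖gradient (coulomb2 σ) x‖ ≤ 1 / ‖x‖ ^ (2 - 1) := fun x hx =>
      norm_gradient_coulomb2_le (abs_eq_one_of_sign hσ) hx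
    have hw : ∀ (t : ℝ) (x v : Sp 2), inner ℝ v (wedge2 v (B t x)) = 0 := fun t x v =>
      inner_wedge2_self v _
    obtain ⟨e, he⟩ := hf.exists_field_bound_two hK hw hT hn2 hQ
    exact hf.densityBounds_of_bounded_field (Or.inl rfl) hK hw hT hn2 hQ he
  · intro σ hσ κ hκ c _ B₀ _
    -- The value 1 is a mere choice: the field bound below comes from the seventh moments and the
    -- linear growth of the field.
    refine ⟨1, one_pos, ?_⟩
    intro T hT n _ hn B fin Min Nin f _ _ _ _ hM hN _ hQ hf
    -- Here b' = 3, so d (b' - 1) = 6 and the moments of order seven are among those assumed finite.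
    have hn6 : 6 < n := by
      norm_num [bConj, bExp] at hn
      exact_mod_cast hn
    have hK : ∀ x ≠ 0, ‖gradient (yukawa3 σ κ) x‖ ≤ 1 / ‖x‖ ^ (3 - 1) := fun x hx =>
      norm_gradient_yukawa3_le (abs_eq_one_of_sign hσ) hκ hx
    have hskew : ∀ (t : ℝ) (x : Sp 3), ∃ M : Sp 3 →L[ℝ] Sp 3,
        (∀ v, wedge3 v (B t x) = M v) ∧ ∀ v, inner ℝ (M v) v = 0 := fun t x =>
      exists_skew_wedge3 _
    have hw : ∀ (t : ℝ) (x v : Sp 3), inner ℝ v (wedge3 v (B t x)) = 0 := fun t x v => by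
      obtain ⟨M, hM, hM0⟩ := hskew t x
      rw [hM, real_inner_comm, hM0]
    obtain ⟨e, he⟩ := hf.exists_field_bound_three hK hT hskew
      ((hM 7 hn6).2.trans_lt ENNReal.ofReal_lt_top) ((hN 7 hn6).2.trans_lt ENNReal.ofReal_lt_top)
    exact hf.densityBounds_of_bounded_field (Or.inr rfl) hK hw hT (by omega) hQ he
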